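/- **Setting.** Let $A$ be the symmetric $0/1$ adjacency matrix of a graph on $n\ge 1$ vertices, let $\beta>0$ and $b\in\mathbb R^n$ with $b_i\ge 0$. In the network game, agent $i$ choosing action $a_i$ has utility $u_i(a)=b_ia_i-\tfrac12a_i^2+\beta\sum_jA_{ij}a_ia_j$; the equilibrium is the solution $a^*=(I-\beta A)^{-1}b$ of $a=b+\beta Aa$. An intervention $y\in\mathbb R^n$ replaces $b$ by $b+y$, and $W(y)$ denotes the social welfare $\sum_iu_i$ at the resulting equilibrium. For a budget $C$, the intervention $y$ is $(1-\epsilon)$-optimal if $\|y\|^2\le C$ and $W(y)\ge(1-\epsilon)W(x)$ for every $x$ with $\|x\|^2\le C$. Throughout, $\|\cdot\|$ is the Euclidean norm and $\lambda_1$ is the largest eigenvalue. A power law $G(w)$ graph with exponent $\sigma$ is given by $w_i=c\,(i+i_0)^{-1/(\sigma-1)}$, $1\le i\le n$, with $c>0$ and an integer $i_0\ge0$, such that $w_1\le\sqrt{\sum_kw_k}$. Put $\bar A_{ij}=w_iw_j/\sum_kw_k$. Each edge $\{i,j\}$ with $i\le j$ is included independently with probability $\bar A_{ij}$; in the variant without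 self-loops the same is done for $i<j$ only, and $A_{ii}=0$. **Theorem.** Let $2<\sigma<2.5$ and $d_0>0$. There are constants $K,c_1>0$ depending only on $\sigma$ and $d_0$, and for every $d_1$ a constant $c_2>0$ depending only on $\sigma,d_0,d_1$, such that the following holds for all $\epsilon,\delta\in(0,1)$ and every power law sequence $w$ as above, of any length $n\geq 1$, with exponent $\sigma$ and average expected degree $d_0\le\frac1n\sum_kw_k\le d_1$ and with $$w_1\ \ge\ K\left(\frac{\log(2n/\delta)}{\epsilon^4}\right)^{\frac1{5-2\sigma}} .$$ 1. $c_1\,w_1^{3-\sigma}\le\lambda_1(\bar A)\le c_2\,w_1^{3-\sigma}$. 2. Let $\beta>0$ and $b\ge0$, and let $A$ be the adjacency matrix of the random graph $G(w)$, with or without self-loops. With probability at least $1-\delta$ the following holds: if $\beta\lambda_1(A)<1$, then for every budget $C\ge\dfrac{256\,\|b\|^2}{(\epsilon\beta\lambda_1(\bar A))^2}$ the intervention $y=\sqrt C\cdot\dfrac{w}{\|w\|}$ is $(1-\epsilon)$-optimal. -/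

import Mathlib

open scoped Matrix

noncomputable section

namespace NetGame

/-- Euclidean norm of a vector. -/
def l2Norm {n : ℕ} (x : Fin n → ℝ) : ℝ :=
  ‖(WithLp.toLp 2 x : EuclideanSpace ℝ (Fin n))‖

/-- The largest eigenvalue `λ₁` of a (symmetric) real matrix. -/
def topEigenvalue {n : ℕ} (A : Matrix (Fin n) (Fin n) ℝ) : ℝ :=
  sSup (spectrum ℝ A)

/-! ### The linear-quadratic network game -/

/-- Utility of agent `i` under the action profile `a`, standalone marginal values `b`. -/
def utility {n : ℕ} (β : ℝ) (A : Matrix (Fin n) (Fin n) ℝ) (b a : Fin n → ℝ) (i : Fin n) : ℝ :=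
  b i * a i - 1 / 2 * a i ^ 2 + β * ∑ j, A i j * a i * a j

/-- The equilibrium actions `a* = (I - β A)⁻¹ b`, i.e. the solution of `a = b + β A a`. -/
def equilibrium {n : ℕ} (β : ℝ) (A : Matrix (Fin n) (Fin n) ℝ) (b : Fin n → ℝ) : Fin n → ℝ :=
  (1 - β • A)⁻¹ *ᵥ b

/-- Social welfare `W(y)` at the equilibrium that follows the intervention `y`, which changes the
standalone marginal values from `b` to `b + y`. -/
def welfare {n : ℕ} (β : ℝ) (A : Matrix (Fin n) (Fin n) ℝ) (b y : Fin n → ℝ) : ℝ :=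
  ∑ i, utility β A (b + y) (equilibrium β A (b + y)) i

/-- `y` respects the budget `C`, and its welfare is at least `1 - ε` times the welfare of every
intervention (hence of an optimal one) that respects the budget `C`. -/
def IsNearOptimal {n : ℕ} (ε β : ℝ) (A : Matrix (Fin n) (Fin n) ℝ) (b : Fin n → ℝ) (C : ℝ)
    (y : Fin n → ℝ) : Prop :=
  l2Norm y ^ 2 ≤ C ∧
    ∀ x : Fin n → ℝ, l2Norm x ^ 2 ≤ C → (1 - ε) * welfare β A b x ≤ welfare β A b y

/-! ### Random graphs with independent edges -/

/-- Unordered pairs of vertices (loops included), written as ordered pairs `(i, j)`, `i ≤ j`. -/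
abbrev EdgeSlot (n : ℕ) : Type := {e : Fin n × Fin n // e.1 ≤ e.2}

/-- Law of the edge indicators: the slot `(i, j)` is occupied with probability `P i j`,
independently over the slots. (Entries of `P` outside `[0, 1]` are clamped.) -/
def edgeLaw {n : ℕ} (P : Matrix (Fin n) (Fin n) ℝ) : MeasureTheory.Measure (EdgeSlot n → Bool) :=
  MeasureTheory.Measure.pi fun e =>
    ProbabilityTheory.bernoulliMeasure true false
      (Set.projIcc (0 : ℝ) 1 zero_le_one (P e.1.1 e.1.2))

/-- The symmetric 0/1 adjacency matrix given by the edge indicators. -/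
def adjacency {n : ℕ} (ω : EdgeSlot n → Bool) : Matrix (Fin n) (Fin n) ℝ :=
  fun i j => if ω ⟨(min i j, max i j), min_le_max⟩ = true then 1 else 0

/-- Expected adjacency matrix of the `G(w)` model. -/
def gwMatrix {n : ℕ} (w : Fin n → ℝ) : Matrix (Fin n) (Fin n) ℝ :=
  fun i j => w i * w j / ∑ k, w k

/-- The matrix with its diagonal set to zero (self-loops disallowed). -/
def dropLoops {n : ℕ} (P : Matrix (Fin n) (Fin n) ℝ) : Matrix (Fin n) (Fin n) ℝ :=
  fun i j => if i = j then 0 else P i j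

/-- The power law sequence `w_i = c (i + i₀)^(-1/(σ-1))`, `i = 1, …, n`
(the entry `w_i` has index `i - 1`). -/
def powerLaw (σ c : ℝ) (i₀ n : ℕ) : Fin n → ℝ :=
  fun i => c * (((i : ℕ) : ℝ) + 1 + (i₀ : ℝ)) ^ (-(1 / (σ - 1)))

end NetGame

end

open scoped Matrix

noncomputable section

namespace NetGame

/-! ### The Lie–Trotter product formula -/

section LieTrotter

open NormedSpace Filter Topology

/-! At equilibrium the welfare is half the squared length of a = (I - βA)⁻¹(b + y) (`welfare_eq`).
Put k = 1 - βλ₁(A). Within the budget, k‖a‖ never exceeds ‖b‖ + √C, while k‖a‖ ≥ |⟨v, b + y⟩| for a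
unit top eigenvector v. The factor k, which may be arbitrarily small, cancels when the two bounds
are compared. So the direction g is nearly optimal once g is almost parallel to v and b is
negligible beside √C. Both follow when the quadratic form of A is within εμ/16 of that of μ g gᵀ
(`isNearOptimal_of_near_rank_one`).

The mean matrix Ā is exactly of this form, with g = w/‖w‖ and μ = λ₁(Ā) = ‖w‖²/∑w, so it remains to
show that μ dominates the fluctuations of A. With L = log(2n/δ) these are at most 2√(w₁L)
(`one_sub_le_edgeLaw_real`), by a matrix Laplace transform. The centred matrix is a sum of
independent terms (X_e - p_e)F_e with F_e³ = F_e. Subtracting the compensator θ²p_eF_e² inside the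
exponent makes the mean of each exponential at most the identity, and Golden–Thompson removes the
slots one at a time (`sum_trace_exp_le`). Since the compensators add up as matrices, to θ² times the
diagonal of expected degrees, only the largest expected degree enters, not a sum of norms.

For a power law, μ is of order w₁^(3-σ) (`le_powerLaw_dotProduct_div`,
`powerLaw_dotProduct_div_le`). It beats √w₁ up to logarithms exactly when 3 - σ > 1/2, that is σ <
5/2 (`spectral_gap_of_le`). -/

theorem norm_pow_sub_pow_le {𝔸 : Type*} [NormedRing 𝔸] [NormOneClass 𝔸] {x y : 𝔸} {M : ℝ}
    (hM : 1 ≤ M) (hx : ‖x‖ ≤ M) (hy : ‖y‖ ≤ M) (n : ℕ) :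
    ‖x ^ n - y ^ n‖ ≤ n * M ^ n * ‖x - y‖ := by
  induction n with
  | zero => simp
  | succ n ih =>
    have h0 : x ^ (n + 1) - y ^ (n + 1) = x * (x ^ n - y ^ n) + (x - y) * y ^ n := by
      rw [pow_succ', pow_succ']; noncomm_ring
    have hyn : ‖y ^ n‖ ≤ M ^ n := (norm_pow_le y n).trans (by gcongr)
    have hMn : M ^ n ≤ M ^ (n + 1) := pow_le_pow_right₀ hM (Nat.le_succ n)
    calc ‖x ^ (n + 1) - y ^ (n + 1)‖ ≤ ‖x‖ * ‖x ^ n - y ^ n‖ + ‖x - y‖ * ‖y ^ n‖ := by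
          rw [h0]
          exact (norm_add_le _ _).trans (add_le_add (norm_mul_le _ _) (norm_mul_le _ _))
      _ ≤ M * (n * M ^ n * ‖x - y‖) + ‖x - y‖ * M ^ (n + 1) := by
          gcongr
          exact hyn.trans hMn
      _ = _ := by push_cast; ring

variable {𝔸 : Type*} [NormedRing 𝔸] [NormedAlgebra ℝ 𝔸] [CompleteSpace 𝔸] [NormOneClass 𝔸]

theorem norm_exp_le_exp_norm (x : 𝔸) : ‖exp x‖ ≤ Real.exp ‖x‖ := by
  have h := (NormedSpace.exp_series_hasSum_exp' (𝕂 := ℝ) x)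
  have h2 := (NormedSpace.exp_series_hasSum_exp' (𝕂 := ℝ) ‖x‖)
  rw [← Real.exp_eq_exp_ℝ] at h2
  rw [← h.tsum_eq]
  refine tsum_of_norm_bounded h2 fun n => ?_
  rw [norm_smul, smul_eq_mul, Real.norm_of_nonneg (by positivity)]
  gcongr
  exact norm_pow_le x n

theorem tendsto_exp_mul_exp_pow (a b : 𝔸) :
    Tendsto (fun n : ℕ => (exp ((n : ℝ)⁻¹ • a) * exp ((n : ℝ)⁻¹ • b)) ^ n) atTop
      (𝓝 (exp (a + b))) := by
  -- The error of one step of size t. Its value and derivative vanish at 0, so n steps of size 1/n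
  -- accumulate n · o(1/n), and the powers stay bounded by exp(‖a‖ + ‖b‖).
  let F : ℝ → 𝔸 := fun t => exp (t • a) * exp (t • b) - exp (t • (a + b))
  have hF : HasDerivAt F 0 0 := by
    have h1 := (hasDerivAt_exp_smul_const (𝕂 := ℝ) a 0).mul (hasDerivAt_exp_smul_const (𝕂 := ℝ) b 0)
    have h2 := h1.sub (hasDerivAt_exp_smul_const (𝕂 := ℝ) (a + b) 0)
    convert! h2 using 1
    simp
  have hF0 : F 0 = 0 := by simp [F]
  have ho : F =o[𝓝 0] fun t => t := by
    have := hF.isLittleO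
    simpa [hF0] using this
  have hinv : Tendsto (fun n : ℕ => (n : ℝ)⁻¹) atTop (𝓝 0) := tendsto_inv_atTop_nhds_zero_nat
  have hlim : Tendsto (fun n : ℕ => (n : ℝ) * ‖F ((n : ℝ)⁻¹)‖) atTop (𝓝 0) := by
    have h := (ho.comp_tendsto hinv).norm_left.tendsto_div_nhds_zero
    refine h.congr fun n => ?_
    simp [div_eq_mul_inv, mul_comm]
  rw [tendsto_iff_norm_sub_tendsto_zero]
  have hlim' : Tendsto (fun n : ℕ => Real.exp (‖a‖ + ‖b‖) * ((n : ℝ) * ‖F ((n : ℝ)⁻¹)‖)) atTop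
      (𝓝 0) := by simpa using hlim.const_mul (Real.exp (‖a‖ + ‖b‖))
  refine squeeze_zero' (Eventually.of_forall fun n => norm_nonneg _) ?_ hlim'
  filter_upwards [eventually_gt_atTop 0] with n hn
  have hn' : (0 : ℝ) < n := by exact_mod_cast hn
  have hs : ∀ x : 𝔸, ‖(n : ℝ)⁻¹ • x‖ = (n : ℝ)⁻¹ * ‖x‖ := fun x => by
    rw [norm_smul, Real.norm_of_nonneg (by positivity)]
  set M := Real.exp ((n : ℝ)⁻¹ * (‖a‖ + ‖b‖)) with hM
  have hMn : M ^ n = Real.exp (‖a‖ + ‖b‖) := by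
    rw [hM, ← Real.exp_nat_mul]; congr 1; field_simp
  have h1 : 1 ≤ M := Real.one_le_exp (by positivity)
  have hx : ‖exp ((n : ℝ)⁻¹ • a) * exp ((n : ℝ)⁻¹ • b)‖ ≤ M := by
    refine (norm_mul_le _ _).trans ?_
    rw [hM, mul_add, Real.exp_add, ← hs, ← hs]
    gcongr <;> exact norm_exp_le_exp_norm _
  have hy : ‖exp ((n : ℝ)⁻¹ • (a + b))‖ ≤ M := by
    refine (norm_exp_le_exp_norm _).trans ?_
    rw [hM, hs]
    gcongr
    exact norm_add_le _ _
  have hpow : exp (a + b) = exp ((n : ℝ)⁻¹ • (a + b)) ^ n := by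
    let _ : NormedAlgebra ℚ 𝔸 := NormedAlgebra.restrictScalars ℚ ℝ 𝔸
    rw [← NormedSpace.exp_nsmul, ← Nat.cast_smul_eq_nsmul ℝ, smul_smul,
      mul_inv_cancel₀ hn'.ne', one_smul]
  rw [hpow]
  refine (norm_pow_sub_pow_le h1 hx hy n).trans (le_of_eq ?_)
  rw [hMn]; simp only [F]; ring

end LieTrotter

/-! ### The Golden–Thompson inequality -/

section GoldenThompson

variable {m : Type*} [Fintype m]

theorem abs_trace_mul_le (A B : Matrix m m ℝ) :
    |(A * B).trace| ≤ ((Aᵀ * A).trace + (Bᵀ * B).trace) / 2 := by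
  have hA : (Aᵀ * A).trace = ∑ i, ∑ j, A i j ^ 2 := by
    simp only [Matrix.trace, Matrix.diag, Matrix.mul_apply, Matrix.transpose_apply]
    rw [Finset.sum_comm]
    simp [sq]
  have hB : (Bᵀ * B).trace = ∑ i, ∑ j, B j i ^ 2 := by
    simp [Matrix.trace, Matrix.mul_apply, sq]
  have hAB : (A * B).trace = ∑ i, ∑ j, A i j * B j i := by
    simp [Matrix.trace, Matrix.mul_apply]
  rw [hA, hB, hAB, ← Finset.sum_add_distrib, Finset.sum_div]
  refine (Finset.abs_sum_le_sum_abs _ _).trans (Finset.sum_le_sum fun i _ => ?_)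
  rw [← Finset.sum_add_distrib, Finset.sum_div]
  refine (Finset.abs_sum_le_sum_abs _ _).trans (Finset.sum_le_sum fun j _ => ?_)
  rw [abs_le]
  constructor <;> nlinarith [sq_nonneg (A i j - B j i), sq_nonneg (A i j + B j i)]

variable [DecidableEq m]

/-- The `2 ^ (k + 1)`-th power of the Schatten norm with exponent `2 ^ (k + 1)`. -/
def schattenPow (k : ℕ) (M : Matrix m m ℝ) : ℝ :=
  ((Mᵀ * M) ^ 2 ^ k).trace

theorem trace_mul_pow_comm (A B : Matrix m m ℝ) (k : ℕ) :
    ((A * B) ^ k).trace = ((B * A) ^ k).trace := by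
  cases k with
  | zero => simp
  | succ k =>
    rw [pow_succ', Matrix.mul_assoc, Matrix.trace_mul_comm, Matrix.mul_assoc,
      Matrix.trace_mul_comm, mul_pow_mul, Matrix.trace_mul_comm, pow_succ', Matrix.mul_assoc]

theorem schattenPow_transpose_mul_self (k : ℕ) (A : Matrix m m ℝ) :
    schattenPow k (Aᵀ * A) = schattenPow (k + 1) A := by
  rw [schattenPow, schattenPow, Matrix.transpose_mul, Matrix.transpose_transpose, ← sq, ← pow_mul,
    pow_succ']

theorem schattenPow_mul_transpose_self (k : ℕ) (A : Matrix m m ℝ) :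
    schattenPow k (A * Aᵀ) = schattenPow (k + 1) A := by
  rw [schattenPow, schattenPow, Matrix.transpose_mul, Matrix.transpose_transpose, ← sq, ← pow_mul,
    trace_mul_pow_comm, pow_succ']

theorem exists_list_pairs {R : Type*} [Monoid R] (k : ℕ) (l : List R) (hl : l.length = 2 * k) :
    ∃ l' : List R, l'.length = k ∧ l'.prod = l.prod ∧
      ∀ x ∈ l', ∃ a ∈ l, ∃ b ∈ l, x = a * b := by
  induction k generalizing l with
  | zero =>
    obtain rfl : l = [] := List.length_eq_zero_iff.1 (by simpa using hl)
    exact ⟨[], by simp⟩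
  | succ k ih =>
    match l, hl with
    | a :: b :: t, hl =>
      obtain ⟨t', h1, h2, h3⟩ := ih t (by simp at hl; omega)
      refine ⟨(a * b) :: t', by simp [h1], by simp [h2, mul_assoc], ?_⟩
      intro x hx
      rcases List.mem_cons.1 hx with rfl | hx
      · exact ⟨a, by simp, b, by simp, rfl⟩
      · obtain ⟨c, hc, d, hd, rfl⟩ := h3 x hx
        exact ⟨c, by simp [hc], d, by simp [hd], rfl⟩

theorem exists_list_mul_pow {R : Type*} [Monoid R] (a b : R) (k : ℕ) :
    ∃ l : List R, l.length = 2 * k ∧ l.prod = (a * b) ^ k ∧ ∀ x ∈ l, x = a ∨ x = b := by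
  induction k with
  | zero => exact ⟨[], by simp⟩
  | succ k ih =>
    obtain ⟨l, h1, h2, h3⟩ := ih
    refine ⟨a :: b :: l, by simp [h1]; ring, by simp [h2, pow_succ', mul_assoc], ?_⟩
    intro x hx
    simp only [List.mem_cons] at hx
    rcases hx with h | h | h
    exacts [Or.inl h, Or.inr h, h3 x h]

/-- A normalized form of Hölder's inequality for Schatten norms. -/
theorem abs_trace_prod_le (k : ℕ) (s : ℝ) (l : List (Matrix m m ℝ)) (hl : l.length = 2 ^ (k + 1))
    (hs : ∀ A ∈ l, schattenPow k A ≤ s) : |l.prod.trace| ≤ s := by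
  induction k generalizing l with
  | zero =>
    match l, hl with
    | [A, B], _ =>
      have hA := hs A (by simp)
      have hB := hs B (by simp)
      simp only [schattenPow, pow_zero, pow_one] at hA hB
      have := abs_trace_mul_le A B
      simp only [List.prod_cons, List.prod_nil, mul_one]
      linarith
  | succ k ih =>
    -- Multiplying neighbours halves the number of factors. The induction hypothesis then needs the
    -- bound s for each product A * B at the lower exponent.
    obtain ⟨l', h1, h2, h3⟩ := exists_list_pairs (2 ^ (k + 1)) l (by rw [hl, pow_succ'])
    rw [← h2]
    refine ih l' h1 fun X hX => ?_
    obtain ⟨A, hA, B, hB, rfl⟩ := h3 X hX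
    -- By cyclicity the quantity for A * B is itself the trace of a product of 2 ^ (k + 1) factors,
    -- alternately AᵀA and BBᵀ, so the same induction hypothesis applies a second time.
    obtain ⟨t, ht1, ht2, ht3⟩ := exists_list_mul_pow (Aᵀ * A) (B * Bᵀ) (2 ^ k)
    have hX : schattenPow k (A * B) = t.prod.trace := by
      rw [ht2, schattenPow, Matrix.transpose_mul, Matrix.mul_assoc, trace_mul_pow_comm]
      simp only [Matrix.mul_assoc]
    rw [hX]
    refine (le_abs_self _).trans (ih t (by rw [ht1, pow_succ']) fun Y hY => ?_)
    rcases ht3 Y hY with rfl | rfl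
    · rw [schattenPow_transpose_mul_self]; exact hs A hA
    · rw [schattenPow_mul_transpose_self]; exact hs B hB

/-- Hölder with equal factors bounds the trace of a power of AB by a Schatten power of AB. For
symmetric A and B, cyclicity turns that into the trace of (A²B²) ^ 2 ^ k, so each step trades one
doubling of the outer exponent for squaring A and B. -/
theorem trace_mul_pow_le (k : ℕ) (A B : Matrix m m ℝ) (hA : Aᵀ = A) (hB : Bᵀ = B) :
    ((A * B) ^ 2 ^ k).trace ≤ (A ^ 2 ^ k * B ^ 2 ^ k).trace := by
  induction k generalizing A B with
  | zero => simp
  | succ k ih =>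
    have h1 : ((A * B) ^ 2 ^ (k + 1)).trace ≤ schattenPow k (A * B) := by
      refine (le_abs_self _).trans ?_
      have := abs_trace_prod_le k (schattenPow k (A * B)) (List.replicate (2 ^ (k + 1)) (A * B))
        (by simp) (fun X hX => by rw [List.eq_of_mem_replicate hX])
      simpa using this
    have h2 : schattenPow k (A * B) = ((A ^ 2 * B ^ 2) ^ 2 ^ k).trace := by
      rw [schattenPow, Matrix.transpose_mul, hA, hB, Matrix.mul_assoc, trace_mul_pow_comm]
      simp only [Matrix.mul_assoc, sq]
    have h3 := ih (A ^ 2) (B ^ 2) (by rw [Matrix.transpose_pow, hA])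
      (by rw [Matrix.transpose_pow, hB])
    rw [← pow_mul, ← pow_mul, ← pow_succ'] at h3
    linarith

open NormedSpace Filter Topology

open scoped Matrix.Norms.Operator in
theorem tendsto_matrix_exp_mul_exp_pow (A B : Matrix m m ℝ) :
    Tendsto (fun n : ℕ => (exp ((n : ℝ)⁻¹ • A) * exp ((n : ℝ)⁻¹ • B)) ^ n) atTop
      (𝓝 (exp (A + B))) := by
  cases isEmpty_or_nonempty m
  · exact tendsto_const_nhds.congr fun n => Subsingleton.elim _ _
  · exact tendsto_exp_mul_exp_pow A B

/-- The **Golden–Thompson inequality** for real symmetric matrices. -/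
theorem trace_exp_add_le (A B : Matrix m m ℝ) (hA : Aᵀ = A) (hB : Bᵀ = B) :
    (exp (A + B)).trace ≤ (exp A * exp B).trace := by
  -- The trace inequality is available for exponents 2 ^ k only, and this subsequence of the
  -- Lie–Trotter limit suffices.
  have h2 : Tendsto (fun k : ℕ => 2 ^ k) atTop (atTop : Filter ℕ) :=
    tendsto_pow_atTop_atTop_of_one_lt (by norm_num)
  have hlim := (tendsto_matrix_exp_mul_exp_pow A B).comp h2
  have hlim' := (Continuous.matrix_trace continuous_id).continuousAt.tendsto.comp hlim
  refine le_of_tendsto hlim' (Eventually.of_forall fun k => ?_)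
  have hsym : ∀ (t : ℝ) (X : Matrix m m ℝ), Xᵀ = X → (exp (t • X))ᵀ = exp (t • X) :=
    fun t X hX => by rw [← Matrix.exp_transpose, Matrix.transpose_smul, hX]
  have hpow : ∀ X : Matrix m m ℝ, exp (((2 ^ k : ℕ) : ℝ)⁻¹ • X) ^ 2 ^ k = exp X := fun X => by
    rw [← Matrix.exp_nsmul, ← Nat.cast_smul_eq_nsmul ℝ, smul_smul, mul_inv_cancel₀ (by positivity),
      one_smul]
  have := trace_mul_pow_le k (exp (((2 ^ k : ℕ) : ℝ)⁻¹ • A)) (exp (((2 ^ k : ℕ) : ℝ)⁻¹ • B))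
    (hsym _ A hA) (hsym _ B hB)
  rw [hpow, hpow] at this
  exact this

end GoldenThompson

/-! ### Spectral facts about real symmetric matrices -/

section Spectral

open NormedSpace

variable {m : Type*} [Fintype m] [DecidableEq m]

/-- With R = exp(D/2) symmetric, cyclicity gives the trace of RQR, which is positive semidefinite.
-/
theorem trace_exp_mul_nonneg {D Q : Matrix m m ℝ} (hD : Dᵀ = D) (hQ : Q.PosSemidef) :
    0 ≤ (exp D * Q).trace := by
  set R := exp ((2 : ℝ)⁻¹ • D) with hR
  have hRt : Rᴴ = R := by
    rw [Matrix.conjTranspose_eq_transpose_of_trivial, hR, ← Matrix.exp_transpose,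
      Matrix.transpose_smul, hD]
  have hRR : exp D = R * R := by
    rw [hR, ← Matrix.exp_add_of_commute _ _ (Commute.refl _), ← add_smul]
    norm_num
  have h := (hQ.conjTranspose_mul_mul_same R).trace_nonneg
  rwa [hRt, Matrix.mul_assoc, Matrix.trace_mul_comm, Matrix.mul_assoc, Matrix.trace_mul_comm,
    ← hRR] at h

open scoped Matrix.Norms.Operator in
theorem exp_smul_of_mul_self_eq {P : Matrix m m ℝ} (hP : P * P = P) (a : ℝ) :
    exp (a • P) = 1 + (Real.exp a - 1) • P := by
  have h := NormedSpace.exp_series_hasSum_exp' (𝕂 := ℝ) (a • P)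
  have h1 : HasSum (fun n : ℕ => (n.factorial⁻¹ : ℝ) • a ^ n) (Real.exp a) := by
    have := NormedSpace.exp_series_hasSum_exp' (𝕂 := ℝ) a
    rwa [← Real.exp_eq_exp_ℝ] at this
  have h2 := (h1.smul_const P).add (hasSum_ite_eq (0 : ℕ) (1 - P))
  have h3 : (fun n : ℕ => (n.factorial⁻¹ : ℝ) • (a • P) ^ n) =
      fun n : ℕ => ((n.factorial⁻¹ : ℝ) • a ^ n) • P + if n = 0 then 1 - P else 0 := by
    funext n
    cases n with
    | zero => simp
    | succ n =>
      have hPn : P ^ (n + 1) = P := (show IsIdempotentElem P from hP).pow_succ_eq n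
      simp [smul_pow, hPn, smul_smul]
  rw [h3] at h
  refine (h.unique h2).trans ?_
  module

theorem exists_eigenvalues_eq_topEigenvalue {n : ℕ} [NeZero n] {A : Matrix (Fin n) (Fin n) ℝ}
    (hH : A.IsHermitian) :
    ∃ i, hH.eigenvalues i = topEigenvalue A ∧ ∀ j, hH.eigenvalues j ≤ topEigenvalue A := by
  obtain ⟨i, hi⟩ := Finite.exists_max hH.eigenvalues
  have htop : topEigenvalue A = hH.eigenvalues i := by
    rw [topEigenvalue, hH.spectrum_real_eq_range_eigenvalues]
    refine IsGreatest.csSup_eq ⟨⟨i, rfl⟩, ?_⟩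
    rintro _ ⟨j, rfl⟩
    exact hi j
  exact ⟨i, htop.symm, fun j => htop ▸ hi j⟩

theorem exists_eigenvector_topEigenvalue {n : ℕ} [NeZero n] {A : Matrix (Fin n) (Fin n) ℝ}
    (hA : Aᵀ = A) :
    ∃ v : Fin n → ℝ, v ⬝ᵥ v = 1 ∧ A *ᵥ v = topEigenvalue A • v ∧
      ∀ x : Fin n → ℝ, x ⬝ᵥ A *ᵥ x ≤ topEigenvalue A * (x ⬝ᵥ x) := by
  have hH : A.IsHermitian := by
    rw [Matrix.IsHermitian, Matrix.conjTranspose_eq_transpose_of_trivial, hA]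
  obtain ⟨i, htop, hi⟩ := exists_eigenvalues_eq_topEigenvalue hH
  rw [← htop] at hi ⊢
  refine ⟨hH.eigenvectorBasis i, ?_, hH.mulVec_eigenvectorBasis i, fun x => ?_⟩
  · have h := hH.eigenvectorBasis.orthonormal.1 i
    have h2 := EuclideanSpace.norm_sq_eq (hH.eigenvectorBasis i)
    rw [h] at h2
    simpa [dotProduct, sq] using h2.symm
  · set U : Matrix (Fin n) (Fin n) ℝ := hH.eigenvectorUnitary.1 with hU
    have hUU : U * Uᴴ = 1 := Matrix.mem_unitaryGroup_iff.1 hH.eigenvectorUnitary.2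
    have hspec : A = U * Matrix.diagonal hH.eigenvalues * Uᴴ := by
      conv_lhs => rw [hH.spectral_theorem, Unitary.conjStarAlgAut_apply]
      rfl
    set y := Uᴴ *ᵥ x with hy
    have hyt : x ᵥ* U = y := by
      rw [hy, Matrix.conjTranspose_eq_transpose_of_trivial, Matrix.mulVec_transpose]
    have hyy : y ⬝ᵥ y = x ⬝ᵥ x := by
      nth_rw 1 [← hyt]
      rw [hy, ← Matrix.dotProduct_mulVec, Matrix.mulVec_mulVec, hUU, Matrix.one_mulVec]
    have h1 : x ⬝ᵥ A *ᵥ x = y ⬝ᵥ Matrix.diagonal hH.eigenvalues *ᵥ y := by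
      conv_lhs => rw [hspec, ← Matrix.mulVec_mulVec, ← Matrix.mulVec_mulVec,
        Matrix.dotProduct_mulVec, hyt]
    rw [h1, ← hyy]
    simp only [dotProduct, Matrix.mulVec_diagonal, Finset.mul_sum]
    refine Finset.sum_le_sum fun j _ => ?_
    nlinarith [hi j, mul_self_nonneg (y j)]

theorem exp_topEigenvalue_le_trace {n : ℕ} [NeZero n] {A : Matrix (Fin n) (Fin n) ℝ}
    (hA : Aᵀ = A) : Real.exp (topEigenvalue A) ≤ (exp A).trace := by
  have hH : A.IsHermitian := by
    rw [Matrix.IsHermitian, Matrix.conjTranspose_eq_transpose_of_trivial, hA]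
  obtain ⟨i, hi, _⟩ := exists_eigenvalues_eq_topEigenvalue hH
  have hspec : A = (Unitary.toUnits hH.eigenvectorUnitary : (Matrix (Fin n) (Fin n) ℝ)ˣ) *
      Matrix.diagonal hH.eigenvalues * ((Unitary.toUnits hH.eigenvectorUnitary)⁻¹ :
        (Matrix (Fin n) (Fin n) ℝ)ˣ) := by
    conv_lhs => rw [hH.spectral_theorem, Unitary.conjStarAlgAut_apply]
    rfl
  have htr : (exp A).trace = ∑ j, Real.exp (hH.eigenvalues j) := by
    conv_lhs => rw [hspec, Matrix.exp_units_conj, Matrix.trace_mul_comm, ← Matrix.mul_assoc,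
      Units.inv_mul, Matrix.one_mul, Matrix.exp_diagonal]
    simp [Matrix.trace, Pi.coe_exp, Real.exp_eq_exp_ℝ]
  rw [htr, ← hi]
  exact Finset.single_le_sum (f := fun j => Real.exp (hH.eigenvalues j))
    (fun j _ => (Real.exp_pos _).le) (Finset.mem_univ i)

theorem exp_rayleigh_le_trace {n : ℕ} [NeZero n] {A : Matrix (Fin n) (Fin n) ℝ} (hA : Aᵀ = A)
    {v : Fin n → ℝ} (hv : v ⬝ᵥ v = 1) : Real.exp (v ⬝ᵥ A *ᵥ v) ≤ (exp A).trace := by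
  obtain ⟨_, _, _, h⟩ := exists_eigenvector_topEigenvalue hA
  refine (Real.exp_le_exp.2 ?_).trans (exp_topEigenvalue_le_trace hA)
  simpa [hv] using h v

/-- The relation F³ = F confines the spectrum to {-1, 0, 1}. The matrices (F² ± F)/2 are orthogonal
idempotents projecting onto the eigenspaces of ±1, where the exponent acts as the scalar y ± x. -/
theorem exp_smul_add_smul_of_pow_three {F : Matrix m m ℝ} (hF : F * F * F = F) (x y : ℝ) :
    exp (x • F + y • (F * F)) = 1 +
      (Real.exp (y + x) - 1) • ((2 : ℝ)⁻¹ • (F * F + F)) +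
      (Real.exp (y - x) - 1) • ((2 : ℝ)⁻¹ • (F * F - F)) := by
  set P := (2 : ℝ)⁻¹ • (F * F + F) with hP
  set Q := (2 : ℝ)⁻¹ • (F * F - F) with hQ
  have hF' : F * (F * F) = F := by rw [← Matrix.mul_assoc, hF]
  have hFF : F * F * (F * F) = F * F := by rw [← Matrix.mul_assoc, hF]
  have hPP : P * P = P := by
    simp only [hP, smul_mul_assoc, mul_smul_comm, add_mul, mul_add, hF, hF', hFF]
    module
  have hQQ : Q * Q = Q := by
    simp only [hQ, smul_mul_assoc, mul_smul_comm, sub_mul, mul_sub, hF, hF', hFF]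
    module
  have hPQ : P * Q = 0 := by
    simp only [hP, hQ, smul_mul_assoc, mul_smul_comm, add_mul, mul_sub, hF, hF', hFF]
    module
  have hQP : Q * P = 0 := by
    simp only [hP, hQ, smul_mul_assoc, mul_smul_comm, sub_mul, mul_add, hF, hF', hFF]
    module
  have hsum : x • F + y • (F * F) = (y + x) • P + (y - x) • Q := by
    simp only [hP, hQ]; module
  rw [hsum, Matrix.exp_add_of_commute, exp_smul_of_mul_self_eq hPP, exp_smul_of_mul_self_eq hQQ]
  · simp only [add_mul, mul_add, one_mul, mul_one, smul_mul_assoc, mul_smul_comm, hPQ, smul_zero,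
      add_zero]
  · simp only [Commute, SemiconjBy, smul_mul_assoc, mul_smul_comm, hPQ, hQP, smul_zero]

end Spectral

/-! ### A matrix Laplace transform bound -/

/-- A compensated Bernoulli exponential: e^θ ≤ 1 + θ + θ² for |θ| ≤ 1, so the term θ²p absorbs
everything left after centring. -/
theorem bernoulli_mgf_le {θ p : ℝ} (hθ : |θ| ≤ 1) (hp : 0 ≤ p) :
    p * Real.exp (-(θ ^ 2 * p) + θ * (1 - p)) + (1 - p) * Real.exp (-(θ ^ 2 * p) + θ * (0 - p)) ≤
      1 := by
  have h1 : Real.exp (-(θ ^ 2 * p) + θ * (1 - p)) =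
      Real.exp (-(θ ^ 2 * p) - θ * p) * Real.exp θ := by
    rw [← Real.exp_add]; congr 1; ring
  have h2 : -(θ ^ 2 * p) + θ * (0 - p) = -(θ ^ 2 * p) - θ * p := by ring
  have h3 : Real.exp θ - 1 - θ ≤ θ ^ 2 :=
    (le_abs_self _).trans (Real.abs_exp_sub_one_sub_id_le hθ)
  have h4 : 1 + p * (Real.exp θ - 1) ≤ Real.exp (p * (Real.exp θ - 1)) := by
    linarith [Real.add_one_le_exp (p * (Real.exp θ - 1))]
  rw [h1, h2]
  calc p * (Real.exp (-(θ ^ 2 * p) - θ * p) * Real.exp θ) +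
        (1 - p) * Real.exp (-(θ ^ 2 * p) - θ * p)
      = Real.exp (-(θ ^ 2 * p) - θ * p) * (1 + p * (Real.exp θ - 1)) := by ring
    _ ≤ Real.exp (-(θ ^ 2 * p) - θ * p) * Real.exp (p * (Real.exp θ - 1)) := by gcongr
    _ = Real.exp (p * (Real.exp θ - 1 - θ - θ ^ 2)) := by rw [← Real.exp_add]; congr 1; ring
    _ ≤ 1 := Real.exp_le_one_iff.2 (by nlinarith)

section Laplace

open NormedSpace

variable {m : Type*} [Fintype m] [DecidableEq m]

/-- The averaged exponential is the identity on ker F and a scalar on each eigenspace ±1. The two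
scalars are the Bernoulli averages at θ and -θ, both at most 1. -/
theorem posSemidef_one_sub_bernoulli_exp {F : Matrix m m ℝ} (hFt : Fᵀ = F) (hF : F * F * F = F)
    {θ p : ℝ} (hθ : |θ| ≤ 1) (hp : 0 ≤ p) :
    (1 - (p • exp ((θ * (1 - p)) • F + (-(θ ^ 2 * p)) • (F * F)) +
      (1 - p) • exp ((θ * (0 - p)) • F + (-(θ ^ 2 * p)) • (F * F)))).PosSemidef := by
  rw [exp_smul_add_smul_of_pow_three hF, exp_smul_add_smul_of_pow_three hF]
  set P := (2 : ℝ)⁻¹ • (F * F + F) with hP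
  set Q := (2 : ℝ)⁻¹ • (F * F - F) with hQ
  have hF' : F * (F * F) = F := by rw [← Matrix.mul_assoc, hF]
  have hFF : F * F * (F * F) = F * F := by rw [← Matrix.mul_assoc, hF]
  have hPP : Pᴴ * P = P := by
    simp only [hP, Matrix.conjTranspose_eq_transpose_of_trivial, Matrix.transpose_smul,
      Matrix.transpose_add, Matrix.transpose_mul, hFt, smul_mul_assoc, mul_smul_comm, add_mul,
      mul_add, hF, hF', hFF]
    module
  have hQQ : Qᴴ * Q = Q := by
    simp only [hQ, Matrix.conjTranspose_eq_transpose_of_trivial, Matrix.transpose_smul,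
      Matrix.transpose_sub, Matrix.transpose_mul, hFt, smul_mul_assoc, mul_smul_comm, sub_mul,
      mul_sub, hF, hF', hFF]
    module
  have hPpos : P.PosSemidef := hPP ▸ Matrix.posSemidef_conjTranspose_mul_self P
  have hQpos : Q.PosSemidef := hQQ ▸ Matrix.posSemidef_conjTranspose_mul_self Q
  have h1 := bernoulli_mgf_le hθ hp
  have h2 := bernoulli_mgf_le (θ := -θ) (p := p) (by rwa [abs_neg]) hp
  have h3 : ∀ x : ℝ, -(θ ^ 2 * p) - θ * x = -((-θ) ^ 2 * p) + (-θ) * x := fun x => by ring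
  rw [h3, h3]
  convert! (hPpos.smul (sub_nonneg.2 h1)).add (hQpos.smul (sub_nonneg.2 h2)) using 1
  module

/-- An exponential supermartingale in trace form. Golden–Thompson splits off one slot with the
others frozen, and averaging that slot replaces its exponential by something at most the identity.
Positivity of the remaining exponential makes the trace respect this order, so no commutation is
needed. -/
theorem sum_trace_exp_le {ι : Type*} [Fintype ι] [DecidableEq ι] (q : ι → Bool → ℝ)
    (H : ι → Bool → Matrix m m ℝ) (hq : ∀ e b, 0 ≤ q e b) (hH : ∀ e b, (H e b)ᵀ = H e b)
    (hle : ∀ e, (1 - ∑ b, q e b • exp (H e b)).PosSemidef) (D : Matrix m m ℝ) (hD : Dᵀ = D) :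
    ∑ ω : ι → Bool, (∏ e, q e (ω e)) * (exp (D + ∑ e, H e (ω e))).trace ≤ (exp D).trace := by
  rename_i inst
  revert q H D inst
  -- Induction on the index type, with invariance under equivalence as its first case. The slot
  -- `none` is the one averaged out in the last case.
  refine Fintype.induction_empty_option
    (P := fun ι _ => ∀ [DecidableEq ι] (q : ι → Bool → ℝ) (H : ι → Bool → Matrix m m ℝ), (∀ e b, 0 ≤ q e b) →
      (∀ e b, (H e b)ᵀ = H e b) → (∀ e, (1 - ∑ b, q e b • exp (H e b)).PosSemidef) →
      ∀ D : Matrix m m ℝ, Dᵀ = D →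
      ∑ ω : ι → Bool, (∏ e, q e (ω e)) * (exp (D + ∑ e, H e (ω e))).trace ≤ (exp D).trace)
    ?_ ?_ ?_ ι
  · intro α β _ f ih _ q H hq hH hle D hD
    let : Fintype α := Fintype.ofEquiv β f.symm
    let : DecidableEq α := f.decidableEq
    have := ih (fun a => q (f a)) (fun a => H (f a)) (fun a => hq _) (fun a => hH _)
      (fun a => hle _) D hD
    refine le_trans (le_of_eq ?_) this
    refine Fintype.sum_equiv (f.arrowCongr (Equiv.refl Bool)).symm _ _ fun ω => ?_
    rw [← Equiv.prod_comp f, ← Equiv.sum_comp f]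
    rfl
  · intro _ q H _ _ _ D _
    simp
  · intro α _ ih _ q H hq hH hle D hD
    let : DecidableEq α := Classical.decEq α
    rw [← Equiv.sum_comp (Equiv.piOptionEquivProd (β := fun _ => Bool)).symm,
      Fintype.sum_prod_type_right]
    refine le_trans (Finset.sum_le_sum fun ω _ => ?_) (ih (fun a => q (some a))
      (fun a => H (some a)) (fun a => hq _) (fun a => hH _) (fun a => hle _) D hD)
    simp only [Fintype.prod_option, Fintype.sum_option, Equiv.piOptionEquivProd]
    set D' := D + ∑ e, H (some e) (ω e) with hD'
    have hDt : D'ᵀ = D' := by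
      rw [hD', Matrix.transpose_add, hD, Matrix.transpose_sum]
      simp only [hH]
    have h1 : ∀ b, (exp (D + (H none b + ∑ e, H (some e) (ω e)))).trace ≤
        (exp D' * exp (H none b)).trace := fun b => by
      rw [show D + (H none b + ∑ e, H (some e) (ω e)) = D' + H none b by rw [hD']; abel]
      exact trace_exp_add_le D' _ hDt (hH _ _)
    have h2 := trace_exp_mul_nonneg hDt (hle none)
    rw [mul_sub, Matrix.trace_sub, mul_one, sub_nonneg, Finset.mul_sum, Matrix.trace_sum] at h2
    simp only [mul_smul_comm, Matrix.trace_smul, smul_eq_mul] at h2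
    have hpos : 0 ≤ ∏ e, q (some e) (ω e) := Finset.prod_nonneg fun e _ => hq _ _
    calc ∑ b, q none b * (∏ e, q (some e) (ω e)) *
          (exp (D + (H none b + ∑ e, H (some e) (ω e)))).trace
        ≤ ∑ b, q none b * (∏ e, q (some e) (ω e)) * (exp D' * exp (H none b)).trace :=
          Finset.sum_le_sum fun b _ =>
            mul_le_mul_of_nonneg_left (h1 b) (mul_nonneg (hq _ _) hpos)
      _ = (∏ e, q (some e) (ω e)) * ∑ b, q none b * (exp D' * exp (H none b)).trace := by
          rw [Finset.mul_sum]
          exact Finset.sum_congr rfl fun b _ => by ring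
      _ ≤ (∏ e, q (some e) (ω e)) * (exp D').trace := mul_le_mul_of_nonneg_left h2 hpos

end Laplace

/-! ### Concentration of the adjacency matrix -/

section Slots

variable {n : ℕ}

/-- The adjacency matrix of the graph whose only edge occupies the slot `e`. -/
def slotMatrix (e : EdgeSlot n) : Matrix (Fin n) (Fin n) ℝ :=
  fun i j => if (i = e.1.1 ∨ i = e.1.2) ∧ j = Equiv.swap e.1.1 e.1.2 i then 1 else 0

theorem slotMatrix_apply (e : EdgeSlot n) (i j : Fin n) :
    slotMatrix e i j = if e = ⟨(min i j, max i j), min_le_max⟩ then 1 else 0 := by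
  obtain ⟨⟨a, b⟩, hab⟩ := e
  simp only [slotMatrix, Subtype.mk.injEq, Prod.mk.injEq]
  simp only at hab
  congr 1
  rw [eq_iff_iff]
  constructor
  · rintro ⟨rfl | rfl, rfl⟩
    · simp [hab]
    · simp [hab]
  · rintro ⟨rfl, rfl⟩
    rcases le_total i j with h | h <;> simp [h]

theorem sum_smul_slotMatrix_apply (f : EdgeSlot n → ℝ) (i j : Fin n) :
    (∑ e, f e • slotMatrix e) i j = f ⟨(min i j, max i j), min_le_max⟩ := by
  simp [Matrix.sum_apply, slotMatrix_apply]

theorem slotMatrix_transpose (e : EdgeSlot n) : (slotMatrix e)ᵀ = slotMatrix e := by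
  ext i j
  simp only [Matrix.transpose_apply, slotMatrix_apply, min_comm, max_comm]

theorem slotMatrix_mul_apply (e : EdgeSlot n) (G : Matrix (Fin n) (Fin n) ℝ) (i k : Fin n) :
    (slotMatrix e * G) i k =
      if i = e.1.1 ∨ i = e.1.2 then G (Equiv.swap e.1.1 e.1.2 i) k else 0 := by
  by_cases h : i = e.1.1 ∨ i = e.1.2 <;> simp [Matrix.mul_apply, slotMatrix, h]

theorem swap_eq_left_or_right {α : Type*} [DecidableEq α] {a b i : α} (h : i = a ∨ i = b) :
    Equiv.swap a b i = a ∨ Equiv.swap a b i = b := by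
  rcases h with rfl | rfl <;> simp

/-- The matrix swaps the two endpoints and kills every other coordinate, so its square is the
projection onto the endpoints. The description by a swap covers loops as well. -/
theorem slotMatrix_mul_mul (e : EdgeSlot n) :
    slotMatrix e * slotMatrix e * slotMatrix e = slotMatrix e := by
  ext i k
  rw [Matrix.mul_assoc, slotMatrix_mul_apply]
  split_ifs with h
  · rw [slotMatrix_mul_apply, if_pos (swap_eq_left_or_right h), Equiv.swap_apply_self]
  · simp [slotMatrix, h]

theorem slotMatrix_mul_self_apply (e : EdgeSlot n) (i k : Fin n) :
    (slotMatrix e * slotMatrix e) i k = if i = k then ∑ j, slotMatrix e i j else 0 := by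
  rw [slotMatrix_mul_apply]
  by_cases h : i = e.1.1 ∨ i = e.1.2
  · rw [if_pos h]
    simp only [slotMatrix, swap_eq_left_or_right h, Equiv.swap_apply_self, h, true_and,
      Finset.sum_ite_eq', Finset.mem_univ, if_true]
    simp [eq_comm]
  · simp [slotMatrix, h]

theorem adjacency_eq_sum (ω : EdgeSlot n → Bool) :
    adjacency ω = ∑ e, (if ω e = true then (1 : ℝ) else 0) • slotMatrix e := by
  ext i j
  rw [sum_smul_slotMatrix_apply, adjacency]

theorem adjacency_transpose (ω : EdgeSlot n → Bool) : (adjacency ω)ᵀ = adjacency ω := by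
  ext i j
  simp only [Matrix.transpose_apply, adjacency, min_comm, max_comm]

theorem eq_sum_smul_slotMatrix {P : Matrix (Fin n) (Fin n) ℝ} (hP : Pᵀ = P) :
    P = ∑ e : EdgeSlot n, P e.1.1 e.1.2 • slotMatrix e := by
  ext i j
  rw [sum_smul_slotMatrix_apply]
  rcases le_total i j with h | h
  · simp [h]
  · simpa [h] using congrFun (congrFun hP j) i

/-- Vertex i collects the probabilities of all slots containing it. This is what makes the total
compensator a diagonal of expected degrees. -/
theorem sum_smul_slotMatrix_mul_self {P : Matrix (Fin n) (Fin n) ℝ} (hP : Pᵀ = P) :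
    ∑ e : EdgeSlot n, P e.1.1 e.1.2 • (slotMatrix e * slotMatrix e) =
      Matrix.diagonal fun i => ∑ j, P i j := by
  ext i k
  simp only [Matrix.sum_apply, Matrix.smul_apply, slotMatrix_mul_self_apply, smul_eq_mul,
    Matrix.diagonal_apply]
  split_ifs with h
  · have h1 : ∀ j, P i j = ∑ e : EdgeSlot n, P e.1.1 e.1.2 * slotMatrix e i j := fun j => by
      conv_lhs => rw [eq_sum_smul_slotMatrix hP]
      simp [Matrix.sum_apply]
    simp only [Finset.mul_sum]
    rw [Finset.sum_comm]
    exact Finset.sum_congr rfl fun j _ => (h1 j).symm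
  · simp

end Slots

section Concentration

open MeasureTheory NormedSpace

variable {n : ℕ}

/-- The weight of the value `b` of the indicator of the slot `e`. -/
def slotWeight (P : Matrix (Fin n) (Fin n) ℝ) (e : EdgeSlot n) (b : Bool) : ℝ :=
  if b = true then P e.1.1 e.1.2 else 1 - P e.1.1 e.1.2

theorem slotWeight_nonneg {P : Matrix (Fin n) (Fin n) ℝ} (h0 : ∀ i j, 0 ≤ P i j)
    (h1 : ∀ i j, P i j ≤ 1) (e : EdgeSlot n) (b : Bool) : 0 ≤ slotWeight P e b := by
  rw [slotWeight]
  split_ifs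
  · exact h0 _ _
  · linarith [h1 e.1.1 e.1.2]

instance (P : Matrix (Fin n) (Fin n) ℝ) : IsProbabilityMeasure (edgeLaw P) := by
  unfold edgeLaw; infer_instance

theorem edgeLaw_real_singleton {P : Matrix (Fin n) (Fin n) ℝ} (h0 : ∀ i j, 0 ≤ P i j)
    (h1 : ∀ i j, P i j ≤ 1) (ω : EdgeSlot n → Bool) :
    (edgeLaw P).real {ω} = ∏ e, slotWeight P e (ω e) := by
  rw [edgeLaw, measureReal_def, Measure.pi_singleton, ENNReal.toReal_prod]
  refine Finset.prod_congr rfl fun e _ => ?_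
  rw [← measureReal_def, Set.projIcc_of_mem zero_le_one ⟨h0 _ _, h1 _ _⟩, slotWeight]
  cases ω e <;> simp

theorem edgeLaw_real_le_sum_div {P : Matrix (Fin n) (Fin n) ℝ} (h0 : ∀ i j, 0 ≤ P i j)
    (h1 : ∀ i j, P i j ≤ 1) (s : Set (EdgeSlot n → Bool)) {t : ℝ} (ht : 0 < t)
    {f : (EdgeSlot n → Bool) → ℝ} (hf : ∀ ω, 0 ≤ f ω) (hs : ∀ ω ∈ s, t ≤ f ω) :
    (edgeLaw P).real s ≤ (∑ ω, (∏ e, slotWeight P e (ω e)) * f ω) / t := by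
  classical
  have hw : ∀ ω : EdgeSlot n → Bool, 0 ≤ ∏ e, slotWeight P e (ω e) := fun ω =>
    Finset.prod_nonneg fun e _ => slotWeight_nonneg h0 h1 _ _
  have hsum : (edgeLaw P).real s = ∑ ω ∈ s.toFinset, ∏ e, slotWeight P e (ω e) := by
    nth_rw 1 [← Set.coe_toFinset s]
    rw [← sum_measureReal_singleton]
    simp only [edgeLaw_real_singleton h0 h1]
  rw [hsum, le_div_iff₀ ht, Finset.sum_mul]
  calc ∑ ω ∈ s.toFinset, (∏ e, slotWeight P e (ω e)) * t
      ≤ ∑ ω ∈ s.toFinset, (∏ e, slotWeight P e (ω e)) * f ω :=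
        Finset.sum_le_sum fun ω hω =>
          mul_le_mul_of_nonneg_left (hs ω (Set.mem_toFinset.1 hω)) (hw ω)
    _ ≤ _ := Finset.sum_le_sum_of_subset_of_nonneg (Finset.subset_univ _)
        fun ω _ _ => mul_nonneg (hw ω) (hf ω)

theorem edgeLaw_real_exists_le {P : Matrix (Fin n) (Fin n) ℝ} [NeZero n] (hP : Pᵀ = P)
    (h0 : ∀ i j, 0 ≤ P i j) (h1 : ∀ i j, P i j ≤ 1) {d : ℝ} (hd : ∀ i, ∑ j, P i j ≤ d) {θ : ℝ}
    (hθ : |θ| ≤ 1) (t : ℝ) :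
    (edgeLaw P).real {ω | ∃ v : Fin n → ℝ, v ⬝ᵥ v = 1 ∧
      t ≤ θ * (v ⬝ᵥ (adjacency ω - P) *ᵥ v)} ≤ n * Real.exp (θ ^ 2 * d - t) := by
  -- The centred slot contribution with its compensator. Summed over the slots this is θ(A - P)
  -- minus θ² times the degree diagonal, whose quadratic form at a unit vector is at most d.
  set H : EdgeSlot n → Bool → Matrix (Fin n) (Fin n) ℝ := fun e b =>
    (θ * ((if b = true then 1 else 0) - P e.1.1 e.1.2)) • slotMatrix e +
      (-(θ ^ 2 * P e.1.1 e.1.2)) • (slotMatrix e * slotMatrix e) with hH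
  have hHt : ∀ e b, (H e b)ᵀ = H e b := fun e b => by
    simp only [hH, Matrix.transpose_add, Matrix.transpose_smul, Matrix.transpose_mul,
      slotMatrix_transpose]
  have hsum : ∀ ω : EdgeSlot n → Bool, ∑ e, H e (ω e) =
      θ • (adjacency ω - P) - θ ^ 2 • Matrix.diagonal fun i => ∑ j, P i j := fun ω => by
    have hA : adjacency ω - P =
        ∑ e : EdgeSlot n, ((if ω e = true then (1 : ℝ) else 0) - P e.1.1 e.1.2) • slotMatrix e := by
      conv_lhs => rw [eq_sum_smul_slotMatrix hP, adjacency_eq_sum, ← Finset.sum_sub_distrib]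
      simp only [sub_smul]
    rw [← sum_smul_slotMatrix_mul_self hP, hA, Finset.smul_sum, Finset.smul_sum, ← Finset.sum_sub_distrib]
    refine Finset.sum_congr rfl fun e _ => ?_
    simp only [hH]
    module
  have hHst : ∀ ω : EdgeSlot n → Bool, (∑ e, H e (ω e))ᵀ = ∑ e, H e (ω e) := fun ω => by
    rw [Matrix.transpose_sum]; simp only [hHt]
  have hmain := sum_trace_exp_le (slotWeight P) H (slotWeight_nonneg h0 h1) hHt
    (fun e => by
      have := posSemidef_one_sub_bernoulli_exp (slotMatrix_transpose e) (slotMatrix_mul_mul e) hθ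
        (h0 e.1.1 e.1.2)
      simpa [hH, slotWeight] using this) 0 (by simp)
  simp only [zero_add, NormedSpace.exp_zero, Matrix.trace_one, Fintype.card_fin] at hmain
  refine (edgeLaw_real_le_sum_div h0 h1 _ (Real.exp_pos (t - θ ^ 2 * d))
    (f := fun ω => (exp (∑ e, H e (ω e))).trace) ?_ ?_).trans ?_
  · intro ω
    exact (Real.exp_pos _).le.trans (exp_topEigenvalue_le_trace (hHst ω))
  · rintro ω ⟨v, hv, hvt⟩
    refine le_trans (Real.exp_le_exp.2 ?_) (exp_rayleigh_le_trace (hHst ω) hv)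
    rw [hsum, Matrix.sub_mulVec, Matrix.smul_mulVec, Matrix.smul_mulVec, dotProduct_sub,
      dotProduct_smul, dotProduct_smul, smul_eq_mul, smul_eq_mul]
    have hdiag : v ⬝ᵥ (Matrix.diagonal fun i => ∑ j, P i j) *ᵥ v ≤ d := by
      calc v ⬝ᵥ (Matrix.diagonal fun i => ∑ j, P i j) *ᵥ v ≤ d * (v ⬝ᵥ v) := by
            simp only [dotProduct, Matrix.mulVec_diagonal, Finset.mul_sum]
            exact Finset.sum_le_sum fun i _ => by nlinarith [hd i, mul_self_nonneg (v i)]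
        _ = d := by rw [hv, mul_one]
    nlinarith [mul_le_mul_of_nonneg_left hdiag (sq_nonneg θ)]
  · rw [div_le_iff₀ (Real.exp_pos _), mul_assoc, ← Real.exp_add]
    simpa using hmain

/-- Deviation of the adjacency matrix of a random graph with independent edges from its mean, in
terms of the largest expected degree. -/
theorem one_sub_le_edgeLaw_real {P : Matrix (Fin n) (Fin n) ℝ} [NeZero n] (hP : Pᵀ = P)
    (h0 : ∀ i j, 0 ≤ P i j) (h1 : ∀ i j, P i j ≤ 1) {d L : ℝ} (hd : ∀ i, ∑ j, P i j ≤ d)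
    (hL : 0 < L) (hLd : L ≤ d) :
    1 - 2 * (n * Real.exp (-L)) ≤ (edgeLaw P).real {ω | ∀ v : Fin n → ℝ,
      |v ⬝ᵥ (adjacency ω - P) *ᵥ v| ≤ 2 * √(d * L) * (v ⬝ᵥ v)} := by
  have hd0 : 0 < d := hL.trans_le hLd
  -- This choice gives θ²d = L. At level t = 2L the tail is n exp(-L), and t/θ = 2√(dL) is the
  -- deviation. The assumption L ≤ d is what ensures θ ≤ 1, and the signs ±θ together account for
  -- the factor 2.
  set θ := √(L / d) with hθ
  have hθ0 : 0 < θ := Real.sqrt_pos.2 (by positivity)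
  have hθ1 : |θ| ≤ 1 := by
    rw [abs_of_pos hθ0, hθ]
    exact Real.sqrt_le_one.2 ((div_le_one hd0).2 hLd)
  have hθd : θ ^ 2 * d = L := by
    rw [hθ, Real.sq_sqrt (by positivity)]; field_simp
  have hθL : θ * √(d * L) = L := by
    rw [hθ, ← Real.sqrt_mul (by positivity), show L / d * (d * L) = L ^ 2 by field_simp,
      Real.sqrt_sq hL.le]
  have hpos := edgeLaw_real_exists_le hP h0 h1 hd hθ1 (2 * L)
  have hneg := edgeLaw_real_exists_le hP h0 h1 hd (θ := -θ) (by rwa [abs_neg]) (2 * L)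
  rw [neg_sq] at hneg
  rw [hθd, show L - 2 * L = -L by ring] at hpos hneg
  set S := {ω | ∀ v : Fin n → ℝ,
      |v ⬝ᵥ (adjacency ω - P) *ᵥ v| ≤ 2 * √(d * L) * (v ⬝ᵥ v)} with hS
  have hcompl : Sᶜ ⊆
      {ω | ∃ v : Fin n → ℝ, v ⬝ᵥ v = 1 ∧ 2 * L ≤ θ * (v ⬝ᵥ (adjacency ω - P) *ᵥ v)} ∪
      {ω | ∃ v : Fin n → ℝ, v ⬝ᵥ v = 1 ∧ 2 * L ≤ -θ * (v ⬝ᵥ (adjacency ω - P) *ᵥ v)} := by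
    intro ω hω
    simp only [hS, Set.mem_compl_iff, Set.mem_ofPred_eq, not_forall, not_le] at hω
    obtain ⟨v, hv⟩ := hω
    have hvv : 0 < v ⬝ᵥ v := by
      refine lt_of_le_of_ne (Finset.sum_nonneg fun i _ => mul_self_nonneg _) fun h => ?_
      rw [dotProduct_self_eq_zero.1 h.symm] at hv
      simp at hv
    set r := √(v ⬝ᵥ v) with hr
    have hr0 : 0 < r := Real.sqrt_pos.2 hvv
    have hrr : r * r = v ⬝ᵥ v := Real.mul_self_sqrt hvv.le
    have hu : (r⁻¹ • v) ⬝ᵥ (r⁻¹ • v) = 1 := by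
      rw [smul_dotProduct, dotProduct_smul, ← hrr, smul_eq_mul, smul_eq_mul]
      field_simp
    have hq : (r⁻¹ • v) ⬝ᵥ (adjacency ω - P) *ᵥ (r⁻¹ • v) =
        (v ⬝ᵥ (adjacency ω - P) *ᵥ v) / (v ⬝ᵥ v) := by
      rw [Matrix.mulVec_smul, smul_dotProduct, dotProduct_smul, ← hrr, smul_eq_mul, smul_eq_mul]
      field_simp
    have habs : |(v ⬝ᵥ (adjacency ω - P) *ᵥ v) / (v ⬝ᵥ v)| =
        |v ⬝ᵥ (adjacency ω - P) *ᵥ v| / (v ⬝ᵥ v) := by rw [abs_div, abs_of_pos hvv]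
    rw [← lt_div_iff₀ hvv, ← habs] at hv
    have h2 : 2 * L = θ * (2 * √(d * L)) := by linarith
    rcases lt_abs.1 hv with h | h
    · refine Or.inl ⟨r⁻¹ • v, hu, ?_⟩
      rw [hq, h2]
      exact (mul_lt_mul_of_pos_left h hθ0).le
    · refine Or.inr ⟨r⁻¹ • v, hu, ?_⟩
      rw [hq, h2]
      have := mul_lt_mul_of_pos_left h hθ0
      linarith
  have hmeas : MeasurableSet S := (Set.toFinite S).measurableSet
  have hb := (measureReal_mono (μ := edgeLaw P) hcompl).trans (measureReal_union_le _ _)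
  rw [probReal_compl_eq_one_sub hmeas] at hb
  linarith

end Concentration

/-! ### Welfare under a matrix close to rank one -/

section Welfare

variable {n : ℕ}

theorem l2Norm_nonneg (x : Fin n → ℝ) : 0 ≤ l2Norm x := norm_nonneg _

theorem l2Norm_sq (x : Fin n → ℝ) : l2Norm x ^ 2 = x ⬝ᵥ x := by
  rw [l2Norm, EuclideanSpace.norm_sq_eq]
  simp [dotProduct, sq]

theorem l2Norm_add_le (x y : Fin n → ℝ) : l2Norm (x + y) ≤ l2Norm x + l2Norm y :=
  norm_add_le (WithLp.toLp 2 x : EuclideanSpace ℝ (Fin n)) (WithLp.toLp 2 y)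

theorem l2Norm_smul (t : ℝ) (x : Fin n → ℝ) : l2Norm (t • x) = |t| * l2Norm x :=
  norm_smul t (WithLp.toLp 2 x : EuclideanSpace ℝ (Fin n))

theorem abs_dotProduct_le (x y : Fin n → ℝ) : |x ⬝ᵥ y| ≤ l2Norm x * l2Norm y := by
  have h := abs_real_inner_le_norm (WithLp.toLp 2 y : EuclideanSpace ℝ (Fin n)) (WithLp.toLp 2 x)
  rw [EuclideanSpace.inner_toLp_toLp, mul_comm] at h
  simpa [l2Norm] using h

variable {A : Matrix (Fin n) (Fin n) ℝ} {β : ℝ}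

theorem equilibrium_sub_smul (hu : IsUnit (1 - β • A)) (z : Fin n → ℝ) :
    equilibrium β A z - β • A *ᵥ equilibrium β A z = z := by
  have h : (1 - β • A) *ᵥ equilibrium β A z = z := by
    rw [equilibrium, Matrix.mulVec_mulVec, Matrix.mul_nonsing_inv _
      ((Matrix.isUnit_iff_isUnit_det _).1 hu), Matrix.one_mulVec]
  rwa [Matrix.sub_mulVec, Matrix.one_mulVec, Matrix.smul_mulVec] at h

/-- Substituting b + y = a - βAa into the utilities cancels the interaction terms and leaves a_i²/2
for each agent. -/
theorem welfare_eq (hu : IsUnit (1 - β • A)) (b y : Fin n → ℝ) :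
    welfare β A b y = 1 / 2 * l2Norm (equilibrium β A (b + y)) ^ 2 := by
  rw [l2Norm_sq, welfare, dotProduct, Finset.mul_sum]
  refine Finset.sum_congr rfl fun i _ => ?_
  set a := equilibrium β A (b + y) with ha
  have hz : (b + y) i = a i - β * ∑ j, A i j * a j := by
    conv_lhs => rw [← equilibrium_sub_smul hu (b + y)]
    simp [Matrix.mulVec, dotProduct, ha]
  have hs : ∑ j, A i j * a i * a j = a i * ∑ j, A i j * a j := by
    rw [Finset.mul_sum]
    exact Finset.sum_congr rfl fun j _ => by ring
  rw [utility, hz, hs]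
  ring

variable [NeZero n]

theorem isUnit_one_sub_smul (hA : Aᵀ = A) (hβ : 0 < β) (h : β * topEigenvalue A < 1) :
    IsUnit (1 - β • A) := by
  obtain ⟨_, _, _, hray⟩ := exists_eigenvector_topEigenvalue hA
  rw [← Matrix.mulVec_injective_iff_isUnit]
  refine (injective_iff_map_eq_zero (Matrix.mulVecLin (1 - β • A))).2 fun x hx => ?_
  rw [Matrix.mulVecLin_apply, Matrix.sub_mulVec, Matrix.one_mulVec, Matrix.smul_mulVec] at hx
  have h1 : x ⬝ᵥ x - β * (x ⬝ᵥ A *ᵥ x) = 0 := by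
    rw [← smul_eq_mul, ← dotProduct_smul, ← dotProduct_sub, hx, dotProduct_zero]
  have h2 := mul_le_mul_of_nonneg_left (hray x) hβ.le
  have h3 : 0 ≤ x ⬝ᵥ x := by rw [← l2Norm_sq]; positivity
  exact dotProduct_self_eq_zero.1 (by nlinarith)

/-- Pair z = a - βAa with a. The Rayleigh bound suffices, so nothing about the smallest eigenvalue
is required. -/
theorem mul_l2Norm_equilibrium_le (hA : Aᵀ = A) (hβ : 0 < β) (h : β * topEigenvalue A < 1)
    (z : Fin n → ℝ) : (1 - β * topEigenvalue A) * l2Norm (equilibrium β A z) ≤ l2Norm z := by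
  obtain ⟨_, _, _, hray⟩ := exists_eigenvector_topEigenvalue hA
  have hz := equilibrium_sub_smul (isUnit_one_sub_smul hA hβ h) z
  set a := equilibrium β A z with ha
  rcases (l2Norm_nonneg a).eq_or_lt with h0 | h0
  · rw [← h0, mul_zero]; exact l2Norm_nonneg z
  · have h1 : a ⬝ᵥ z = a ⬝ᵥ a - β * (a ⬝ᵥ A *ᵥ a) := by
      conv_lhs => rw [← hz]
      rw [dotProduct_sub, dotProduct_smul, smul_eq_mul]
    have h2 := mul_le_mul_of_nonneg_left (hray a) hβ.le
    have h3 := (le_abs_self _).trans (abs_dotProduct_le a z)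
    have h4 := l2Norm_sq a
    refine le_of_mul_le_mul_left (a := l2Norm a) ?_ h0
    nlinarith

/-- Along the eigenvector v, the map I - βA is multiplication by 1 - βλ₁. Cauchy–Schwarz then bounds
the component of a along v by its length. -/
theorem dotProduct_le_mul_l2Norm_equilibrium (hA : Aᵀ = A) (hβ : 0 < β)
    (h : β * topEigenvalue A < 1) {v : Fin n → ℝ} (hv : v ⬝ᵥ v = 1)
    (hAv : A *ᵥ v = topEigenvalue A • v) (z : Fin n → ℝ) :
    |v ⬝ᵥ z| ≤ (1 - β * topEigenvalue A) * l2Norm (equilibrium β A z) := by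
  have hz := equilibrium_sub_smul (isUnit_one_sub_smul hA hβ h) z
  set a := equilibrium β A z with ha
  have h1 : v ⬝ᵥ A *ᵥ a = topEigenvalue A * (v ⬝ᵥ a) := by
    rw [Matrix.dotProduct_mulVec, ← Matrix.mulVec_transpose, hA, hAv, smul_dotProduct, smul_eq_mul]
  have h2 : v ⬝ᵥ z = (1 - β * topEigenvalue A) * (v ⬝ᵥ a) := by
    conv_lhs => rw [← hz]
    rw [dotProduct_sub, dotProduct_smul, smul_eq_mul, h1]
    ring
  have hv1 : l2Norm v = 1 := by
    rw [← sq_eq_sq₀ (l2Norm_nonneg v) zero_le_one, l2Norm_sq, hv, one_pow]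
  have h3 := abs_dotProduct_le v a
  rw [hv1, one_mul] at h3
  rw [h2, abs_mul, abs_of_pos (by linarith)]
  exact mul_le_mul_of_nonneg_left h3 (by linarith)

/-- If `A` is close to the rank one matrix `μ g gᵀ`, then spending a large budget in the direction
of `g` is nearly optimal. -/
theorem isNearOptimal_of_near_rank_one (hA : Aᵀ = A) (hβ : 0 < β) (h : β * topEigenvalue A < 1)
    {g : Fin n → ℝ} (hg : l2Norm g = 1) {μ ε : ℝ} (hμ : 0 < μ) (hε : 0 < ε) (hε1 : ε < 1)
    (hnear : ∀ v : Fin n → ℝ, |v ⬝ᵥ A *ᵥ v - μ * (v ⬝ᵥ g) ^ 2| ≤ ε / 16 * μ * (v ⬝ᵥ v))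
    {b : Fin n → ℝ} {C : ℝ} (hC : 256 * l2Norm b ^ 2 / (ε * β * μ) ^ 2 ≤ C) :
    IsNearOptimal ε β A b C (√C • g) := by
  obtain ⟨v, hv, hAv, hray⟩ := exists_eigenvector_topEigenvalue hA
  have hu := isUnit_one_sub_smul hA hβ h
  have hgg : g ⬝ᵥ g = 1 := by rw [← l2Norm_sq, hg, one_pow]
  have hC0 : 0 ≤ C := le_trans (by positivity) hC
  have hCC : √C ^ 2 = C := Real.sq_sqrt hC0
  have hl1 : (1 - ε / 16) * μ ≤ topEigenvalue A := by
    have h1 := (abs_le.1 (hnear g)).1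
    have h2 := hray g
    rw [hgg] at h1 h2
    linarith
  -- Testing closeness at g gives λ₁(A) ≥ (1 - ε/16)μ, and testing it at v gives λ₁(A) ≤ μ⟨v, g⟩² +
  -- (ε/16)μ.
  have hτ : 1 - ε / 8 ≤ (v ⬝ᵥ g) ^ 2 := by
    have h1 := (abs_le.1 (hnear v)).2
    rw [hAv, dotProduct_smul, smul_eq_mul, hv] at h1
    refine le_of_mul_le_mul_left (a := μ) ?_ hμ
    linarith
  have hτ' : 1 - ε / 8 ≤ |v ⬝ᵥ g| := by
    refine abs_le_of_sq_le_sq' ?_ (abs_nonneg _) |>.2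
    rw [sq_abs]
    nlinarith
  have hβμ : β * μ ≤ 16 / 15 := by
    have := mul_le_mul_of_nonneg_left hl1 hβ.le
    have hp : 0 < β * μ := by positivity
    nlinarith
  -- Since 256 = 16², the budget condition reads ‖b‖ ≤ εβμ√C/16, and βμ ≤ 16/15.
  have hb : l2Norm b ≤ ε / 15 * √C := by
    refine abs_le_of_sq_le_sq' ?_ (by positivity) |>.2
    rw [div_le_iff₀ (by positivity)] at hC
    rw [mul_pow, hCC]
    have h1 : (ε * β * μ) ^ 2 ≤ (ε * (16 / 15)) ^ 2 := by
      rw [mul_assoc]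
      gcongr
    have h2 := mul_le_mul_of_nonneg_left h1 hC0
    linarith
  have hk : 0 < 1 - β * topEigenvalue A := by linarith
  set k := 1 - β * topEigenvalue A with hkdef
  refine ⟨?_, fun x hx => ?_⟩
  · rw [l2Norm_smul, hg, mul_one, sq_abs, hCC]
  rw [welfare_eq hu, welfare_eq hu]
  have hxC : l2Norm x ≤ √C := Real.le_sqrt_of_sq_le hx
  have hup : k * l2Norm (equilibrium β A (b + x)) ≤ √C * (1 + ε / 15) := by
    have h1 := mul_l2Norm_equilibrium_le hA hβ h (b + x)
    have h2 := l2Norm_add_le b x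
    linarith
  have hlow : √C * (1 - ε / 8 - ε / 15) ≤ k * l2Norm (equilibrium β A (b + √C • g)) := by
    have h1 := dotProduct_le_mul_l2Norm_equilibrium hA hβ h hv hAv (b + √C • g)
    have h2 := abs_dotProduct_le v b
    have hv1 : l2Norm v = 1 := by
      rw [← sq_eq_sq₀ (l2Norm_nonneg v) zero_le_one, l2Norm_sq, hv, one_pow]
    rw [hv1, one_mul] at h2
    rw [dotProduct_add, dotProduct_smul, smul_eq_mul] at h1
    have h3 := abs_sub_abs_le_abs_sub (√C * (v ⬝ᵥ g)) (-(v ⬝ᵥ b))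
    rw [abs_neg, sub_neg_eq_add, add_comm (√C * (v ⬝ᵥ g)), abs_mul,
      abs_of_nonneg (Real.sqrt_nonneg C)] at h3
    have h4 := mul_le_mul_of_nonneg_left hτ' (Real.sqrt_nonneg C)
    linarith
  have hup2 := pow_le_pow_left₀ (mul_nonneg hk.le (l2Norm_nonneg _)) hup 2
  have hlow2 := pow_le_pow_left₀
    (mul_nonneg (Real.sqrt_nonneg C) (by linarith : 0 ≤ 1 - ε / 8 - ε / 15)) hlow 2
  rw [mul_pow, mul_pow, hCC] at hup2 hlow2
  -- The squared ratio of the two bounds, after k² and C have been divided out.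
  have hpoly : (1 - ε) * (1 + ε / 15) ^ 2 ≤ (1 - ε / 8 - ε / 15) ^ 2 := by
    nlinarith [mul_pos hε hε, mul_pos (mul_pos hε hε) hε]
  refine le_of_mul_le_mul_left (a := k ^ 2) ?_ (by positivity)
  have h1 := mul_le_mul_of_nonneg_left hup2 (by linarith : 0 ≤ 1 - ε)
  have h2 := mul_le_mul_of_nonneg_left hpoly hC0
  linarith

end Welfare

/-! ### The expected adjacency matrix -/

section Expected

variable {n : ℕ}

theorem gwMatrix_transpose (w : Fin n → ℝ) : (gwMatrix w)ᵀ = gwMatrix w := by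
  ext i j
  simp [gwMatrix, mul_comm]

theorem dotProduct_gwMatrix_mulVec (w v : Fin n → ℝ) :
    v ⬝ᵥ gwMatrix w *ᵥ v = (v ⬝ᵥ w) ^ 2 / ∑ k, w k := by
  have h : gwMatrix w *ᵥ v = ((v ⬝ᵥ w) / ∑ k, w k) • w := by
    ext i
    simp only [gwMatrix, Matrix.mulVec, dotProduct, Pi.smul_apply, smul_eq_mul, Finset.sum_div,
      Finset.sum_mul]
    exact Finset.sum_congr rfl fun j _ => by ring
  rw [h, dotProduct_smul, smul_eq_mul]
  ring

theorem topEigenvalue_gwMatrix [NeZero n] {w : Fin n → ℝ} (hw : ∀ i, 0 < w i) :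
    topEigenvalue (gwMatrix w) = (w ⬝ᵥ w) / ∑ k, w k := by
  obtain ⟨v, hv, hAv, hray⟩ := exists_eigenvector_topEigenvalue (gwMatrix_transpose w)
  have hS : 0 < ∑ k, w k := Finset.sum_pos (fun i _ => hw i) Finset.univ_nonempty
  have hT : 0 < w ⬝ᵥ w := Finset.sum_pos (fun i _ => mul_pos (hw i) (hw i)) Finset.univ_nonempty
  refine le_antisymm ?_ ?_
  · have h1 := dotProduct_gwMatrix_mulVec w v
    rw [hAv, dotProduct_smul, hv, smul_eq_mul, mul_one] at h1
    rw [h1]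
    have h2 := abs_dotProduct_le v w
    have h3 : (v ⬝ᵥ w) ^ 2 ≤ (l2Norm v * l2Norm w) ^ 2 := sq_le_sq' (abs_le.1 h2).1 (abs_le.1 h2).2
    rw [mul_pow, l2Norm_sq, l2Norm_sq, hv, one_mul] at h3
    gcongr
  · have h1 := hray w
    rw [dotProduct_gwMatrix_mulVec] at h1
    refine le_of_mul_le_mul_right (a := w ⬝ᵥ w) (le_trans (le_of_eq ?_) h1) hT
    ring

end Expected

/-! ### Power law sequences -/

section PowerLaw

/-- A telescoping substitute for comparing the sum with an integral, obtained from 1 + u ≤ exp u and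
log u ≤ u - 1. -/
theorem mul_rpow_le_rpow_sub_rpow {s x : ℝ} (hs : 0 < s) (hx : 0 < x) :
    s * (x + 1) ^ (-(s + 1)) ≤ x ^ (-s) - (x + 1) ^ (-s) := by
  have hx1 : 0 < x + 1 := by linarith
  have h1 : (x + 1) ^ (-(s + 1)) = (x + 1) ^ (-s) / (x + 1) := by
    rw [neg_add, ← sub_eq_add_neg, Real.rpow_sub_one hx1.ne']
  have h2 : x ^ (-s) = (x + 1) ^ (-s) * (x / (x + 1)) ^ (-s) := by
    rw [← Real.mul_rpow hx1.le (by positivity)]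
    congr 1
    field_simp
  have h3 : 1 + s / (x + 1) ≤ (x / (x + 1)) ^ (-s) := by
    rw [Real.rpow_def_of_pos (by positivity)]
    have h4 : Real.log (x / (x + 1)) ≤ -(1 / (x + 1)) :=
      (Real.log_le_sub_one_of_pos (by positivity)).trans (le_of_eq (by field_simp; ring))
    have h5 := Real.add_one_le_exp (Real.log (x / (x + 1)) * -s)
    have h6 : s / (x + 1) ≤ Real.log (x / (x + 1)) * -s := by
      have := mul_le_mul_of_nonneg_left h4 hs.le
      rw [div_eq_mul_one_div s]
      linarith
    linarith
  rw [h1, h2]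
  have h7 := mul_le_mul_of_nonneg_left h3 (Real.rpow_nonneg hx1.le (-s))
  have h8 : s * ((x + 1) ^ (-s) / (x + 1)) = (x + 1) ^ (-s) * (s / (x + 1)) := by ring
  rw [h8]
  linarith

theorem mul_rpow_le_rpow_sub_rpow' {t x : ℝ} (ht : 0 < t) (ht1 : t ≤ 1) (hx : 0 ≤ x) :
    t * (x + 1) ^ (t - 1) ≤ (x + 1) ^ t - x ^ t := by
  have hx1 : 0 < x + 1 := by linarith
  have h2 : x ^ t = (x + 1) ^ t * (1 + -(1 / (x + 1))) ^ t := by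
    have h : 1 + -(1 / (x + 1)) = x / (x + 1) := by field_simp; ring
    rw [h, ← Real.mul_rpow hx1.le (by positivity)]
    congr 1
    field_simp
  have h3 : (1 + -(1 / (x + 1))) ^ t ≤ 1 + t * -(1 / (x + 1)) :=
    rpow_one_add_le_one_add_mul_self
      (neg_le_neg ((div_le_one hx1).2 (by linarith))) ht.le ht1
  rw [Real.rpow_sub_one hx1.ne', h2]
  have h7 := mul_le_mul_of_nonneg_left h3 (Real.rpow_nonneg hx1.le t)
  have h8 : t * ((x + 1) ^ t / (x + 1)) = (x + 1) ^ t * (t * (1 / (x + 1))) := by ring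
  rw [h8]
  linarith

theorem sum_range_rpow_neg_le {r a : ℝ} (hr : 1 < r) (ha : 1 ≤ a) (n : ℕ) :
    ∑ i ∈ Finset.range n, ((i : ℝ) + a) ^ (-r) ≤ (1 + 1 / (r - 1)) * (a * a ^ (-r)) := by
  have ha0 : 0 < a := by linarith
  have hr0 : 0 < r - 1 := by linarith
  have key : ∀ m : ℕ, ∑ i ∈ Finset.range m, ((i : ℝ) + a + 1) ^ (-r) ≤
      (a ^ (-(r - 1)) - ((m : ℝ) + a) ^ (-(r - 1))) / (r - 1) := by
    intro m
    induction m with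
    | zero => simp
    | succ m ih =>
      rw [Finset.sum_range_succ]
      have h := mul_rpow_le_rpow_sub_rpow hr0 (by positivity : 0 < (m : ℝ) + a)
      rw [sub_add_cancel] at h
      rw [le_div_iff₀ hr0] at ih ⊢
      push_cast
      rw [add_right_comm (m : ℝ) 1 a]
      linarith
  have haa : a ^ (-(r - 1)) = a * a ^ (-r) := by
    rw [neg_sub, sub_eq_add_neg, Real.rpow_add ha0, Real.rpow_one]
  have hle : a ^ (-r) ≤ a * a ^ (-r) := le_mul_of_one_le_left (by positivity) ha
  have htail : ∀ m : ℕ, ∑ i ∈ Finset.range m, ((i : ℝ) + a + 1) ^ (-r) ≤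
      1 / (r - 1) * (a * a ^ (-r)) := fun m => by
    refine (key m).trans ?_
    rw [← one_div_mul_eq_div, haa]
    gcongr
    have : 0 ≤ ((m : ℝ) + a) ^ (-(r - 1)) := by positivity
    linarith
  cases n with
  | zero => simp; positivity
  | succ n =>
    rw [Finset.sum_range_succ']
    have h := htail n
    have h2 : ∀ i : ℕ, ((i + 1 : ℕ) : ℝ) + a = (i : ℝ) + a + 1 := fun i => by push_cast; ring
    simp only [h2, Nat.cast_zero, zero_add]
    linarith

/-- For exponents below 1 the shift a may be replaced by 1 at no cost; the sum then telescopes. -/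
theorem sum_range_rpow_neg_le' {α a : ℝ} (hα0 : 0 ≤ α) (hα : α < 1) (ha : 1 ≤ a) (n : ℕ) :
    ∑ i ∈ Finset.range n, ((i : ℝ) + a) ^ (-α) ≤ (n : ℝ) ^ (1 - α) / (1 - α) := by
  have h1 : 0 < 1 - α := by linarith
  induction n with
  | zero => simp [Real.zero_rpow h1.ne']
  | succ m ih =>
    rw [Finset.sum_range_succ]
    have h := mul_rpow_le_rpow_sub_rpow' h1 (by linarith) (Nat.cast_nonneg m)
    rw [show 1 - α - 1 = -α by ring] at h
    have h2 : ((m : ℝ) + a) ^ (-α) ≤ ((m : ℝ) + 1) ^ (-α) :=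
      Real.rpow_le_rpow_of_nonpos (by positivity) (by linarith) (by linarith)
    rw [le_div_iff₀ h1] at ih ⊢
    push_cast
    nlinarith

variable {σ c : ℝ} {i₀ n : ℕ}

theorem powerLaw_pos (hc : 0 < c) (i : Fin n) : 0 < powerLaw σ c i₀ n i := by
  unfold powerLaw; positivity

theorem powerLaw_le_powerLaw_zero [NeZero n] (hσ : 1 < σ) (hc : 0 < c) (i : Fin n) :
    powerLaw σ c i₀ n i ≤ powerLaw σ c i₀ n 0 := by
  have h : 0 < σ - 1 := by linarith
  unfold powerLaw
  refine mul_le_mul_of_nonneg_left (Real.rpow_le_rpow_of_nonpos (by positivity) ?_ ?_) hc.le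
  · simp
  · exact neg_nonpos.2 (by positivity)

theorem two_rpow_mul_powerLaw_zero_le [NeZero n] (hσ : 1 < σ) (hc : 0 < c) (i : Fin n)
    (hi : (i : ℕ) ≤ i₀) :
    2 ^ (-(1 / (σ - 1))) * powerLaw σ c i₀ n 0 ≤ powerLaw σ c i₀ n i := by
  have h : 0 < σ - 1 := by linarith
  have hi' : ((i : ℕ) : ℝ) ≤ i₀ := by exact_mod_cast hi
  unfold powerLaw
  rw [mul_left_comm, ← Real.mul_rpow (by norm_num) (by positivity)]
  refine mul_le_mul_of_nonneg_left (Real.rpow_le_rpow_of_nonpos (by positivity) ?_ ?_) hc.le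
  · simp only [Fin.val_zero, Nat.cast_zero]; linarith
  · exact neg_nonpos.2 (by positivity)

theorem two_rpow_mul_le_powerLaw (hσ : 1 < σ) (hc : 0 < c) (i : Fin n) (hn : i₀ < n) :
    2 ^ (-(1 / (σ - 1))) * (c * (n : ℝ) ^ (-(1 / (σ - 1)))) ≤ powerLaw σ c i₀ n i := by
  have h : 0 < σ - 1 := by linarith
  have hi' : ((i : ℕ) : ℝ) + 1 ≤ n := by exact_mod_cast i.2
  have hn' : (i₀ : ℝ) + 1 ≤ n := by exact_mod_cast hn
  unfold powerLaw
  rw [mul_left_comm, ← Real.mul_rpow (by norm_num) (by positivity)]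
  refine mul_le_mul_of_nonneg_left (Real.rpow_le_rpow_of_nonpos (by positivity) ?_ ?_) hc.le
  · linarith
  · exact neg_nonpos.2 (by positivity)

theorem sum_powerLaw_le [NeZero n] (hσ : 2 < σ) (hc : 0 < c) :
    ∑ i, powerLaw σ c i₀ n i ≤ c * (n : ℝ) ^ (-(1 / (σ - 1))) * n / (1 - 1 / (σ - 1)) := by
  have hα : 1 / (σ - 1) < 1 := (div_lt_one (by linarith)).2 (by linarith)
  have hα0 : 0 ≤ 1 / (σ - 1) := div_nonneg zero_le_one (by linarith)
  have hn : (0 : ℝ) < n := by exact_mod_cast NeZero.pos n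
  have h := sum_range_rpow_neg_le' hα0 hα (a := 1 + i₀) (by simp) n
  have h2 := mul_le_mul_of_nonneg_left h hc.le
  rw [Finset.mul_sum, ← Fin.sum_univ_eq_sum_range
    (fun i : ℕ => c * ((i : ℝ) + (1 + i₀)) ^ (-(1 / (σ - 1))))] at h2
  simp only [powerLaw, add_assoc]
  refine h2.trans (le_of_eq ?_)
  rw [sub_eq_add_neg, Real.rpow_add hn, Real.rpow_one]
  ring

theorem powerLaw_dotProduct_le [NeZero n] (hσ : 1 < σ) (hσ' : σ < 3) :
    powerLaw σ c i₀ n ⬝ᵥ powerLaw σ c i₀ n ≤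
      (1 + 1 / (2 / (σ - 1) - 1)) * ((1 + i₀) * powerLaw σ c i₀ n 0 ^ 2) := by
  have h0 : 0 < σ - 1 := by linarith
  have hr : 1 < 2 / (σ - 1) := (one_lt_div h0).2 (by linarith)
  have hsq : ∀ x : ℝ, 0 < x → (c * x ^ (-(1 / (σ - 1)))) ^ 2 = c ^ 2 * x ^ (-(2 / (σ - 1))) :=
    fun x hx => by
      rw [mul_pow, ← Real.rpow_natCast (x ^ _), ← Real.rpow_mul hx.le]
      congr 2
      push_cast
      ring
  have h := mul_le_mul_of_nonneg_left
    (sum_range_rpow_neg_le hr (a := 1 + i₀) (by simp) n) (sq_nonneg c)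
  rw [Finset.mul_sum, ← Fin.sum_univ_eq_sum_range
    (fun i : ℕ => c ^ 2 * ((i : ℝ) + (1 + i₀)) ^ (-(2 / (σ - 1))))] at h
  have hl : powerLaw σ c i₀ n ⬝ᵥ powerLaw σ c i₀ n =
      ∑ i : Fin n, c ^ 2 * ((i : ℝ) + (1 + i₀)) ^ (-(2 / (σ - 1))) := by
    refine Finset.sum_congr rfl fun i _ => ?_
    rw [← sq, powerLaw, add_assoc, hsq _ (by positivity)]
  have hz : powerLaw σ c i₀ n 0 ^ 2 = c ^ 2 * (1 + i₀ : ℝ) ^ (-(2 / (σ - 1))) := by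
    rw [powerLaw, ← hsq _ (by positivity)]
    simp
  rw [hl, hz]
  refine h.trans (le_of_eq ?_)
  ring

/-- Let θ = c n^(-1/(σ-1)). Then 1 + i₀ = (c/w₁)^(σ-1) and n = (c/θ)^(σ-1), and c cancels from the
quotient. This identity is the source of the exponent 3 - σ; θ itself is controlled by the average
degree. -/
theorem mul_powerLaw_zero_sq_div [NeZero n] (hσ : 1 < σ) (hc : 0 < c) :
    (1 + i₀) * powerLaw σ c i₀ n 0 ^ 2 / (c * (n : ℝ) ^ (-(1 / (σ - 1))) * n) =
      powerLaw σ c i₀ n 0 ^ (3 - σ) * (c * (n : ℝ) ^ (-(1 / (σ - 1)))) ^ (σ - 2) := by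
  have hn : (0 : ℝ) < n := by exact_mod_cast NeZero.pos n
  have ha : (0 : ℝ) < 1 + i₀ := by positivity
  have hz : powerLaw σ c i₀ n 0 = c * (1 + i₀ : ℝ) ^ (-(1 / (σ - 1))) := by simp [powerLaw]
  rw [hz]
  obtain ⟨γ, rfl⟩ : ∃ γ, c = Real.exp γ := ⟨Real.log c, (Real.exp_log hc).symm⟩
  obtain ⟨ν, hν⟩ : ∃ ν, (n : ℝ) = Real.exp ν := ⟨Real.log n, (Real.exp_log hn).symm⟩
  obtain ⟨x, hx⟩ : ∃ x, (1 + i₀ : ℝ) = Real.exp x := ⟨Real.log (1 + i₀), (Real.exp_log ha).symm⟩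
  rw [hν, hx]
  simp only [← Real.exp_mul, ← Real.exp_add, ← Real.exp_nat_mul, ← Real.exp_sub]
  congr 1
  have h0 : σ - 1 ≠ 0 := by linarith
  field_simp
  ring

theorem le_powerLaw_dotProduct_div [NeZero n] (hσ : 2 < σ) (hc : 0 < c) {d₀ : ℝ} (hd₀ : 0 < d₀)
    (h1 : 1 ≤ powerLaw σ c i₀ n 0) (hd : d₀ ≤ (∑ k, powerLaw σ c i₀ n k) / n) :
    (2 ^ (-(1 / (σ - 1)))) ^ 2 *
        min 1 ((1 - 1 / (σ - 1)) * (d₀ * (1 - 1 / (σ - 1))) ^ (σ - 2)) *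
        powerLaw σ c i₀ n 0 ^ (3 - σ) ≤
      (powerLaw σ c i₀ n ⬝ᵥ powerLaw σ c i₀ n) / ∑ k, powerLaw σ c i₀ n k := by
  have hn : (0 : ℝ) < n := by exact_mod_cast NeZero.pos n
  have hσ1 : 1 < σ := by linarith
  have hα : 1 / (σ - 1) < 1 := (div_lt_one (by linarith)).2 (by linarith)
  have hS : 0 < ∑ k, powerLaw σ c i₀ n k :=
    Finset.sum_pos (fun i _ => powerLaw_pos hc i) Finset.univ_nonempty
  have hsum := sum_powerLaw_le (i₀ := i₀) (n := n) hσ hc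
  have hkey := mul_powerLaw_zero_sq_div (i₀ := i₀) (n := n) hσ1 hc
  have hhalf := two_rpow_mul_powerLaw_zero_le (n := n) (i₀ := i₀) hσ1 hc
  set w := powerLaw σ c i₀ n with hw
  set α := 1 / (σ - 1) with hαdef
  set κ : ℝ := 2 ^ (-α) with hκ
  set θ := c * (n : ℝ) ^ (-α) with hθ
  have hκ0 : 0 < κ := by positivity
  have hθ0 : 0 < θ := by positivity
  have hη0 : 0 < 1 - α := by linarith
  have hw0 : 0 < w 0 := by linarith
  have hcount : ∀ m : ℕ, m ≤ n → m ≤ i₀ + 1 → m * (κ * w 0) ^ 2 ≤ w ⬝ᵥ w := fun m hm hm' => by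
    have hsub : ∑ i ∈ Finset.univ.filter (fun i : Fin n => (i : ℕ) < m), (κ * w 0) ^ 2 ≤
        ∑ i ∈ Finset.univ.filter (fun i : Fin n => (i : ℕ) < m), w i * w i := by
      refine Finset.sum_le_sum fun i hi => ?_
      rw [← sq]
      exact pow_le_pow_left₀ (by positivity)
        (hhalf i (by have := (Finset.mem_filter.1 hi).2; omega)) 2
    rw [Finset.sum_const, Fin.card_filter_val_lt, min_eq_right hm, nsmul_eq_mul] at hsub
    exact hsub.trans (Finset.sum_le_sum_of_subset_of_nonneg (Finset.filter_subset _ _)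
      fun i _ _ => mul_self_nonneg _)
  have hwle : ∀ i, w i ≤ w 0 := powerLaw_le_powerLaw_zero hσ1 hc
  rw [le_div_iff₀ hS]
  generalize 1 - α = η at hη0 hsum ⊢
  clear_value κ θ w
  rcases lt_or_ge i₀ n with hlt | hge
  · have hT := hcount (i₀ + 1) hlt le_rfl
    have hθd : d₀ * η ≤ θ := by
      rw [le_div_iff₀ hn] at hd
      rw [le_div_iff₀ hη0] at hsum
      have h2 := (mul_le_mul_of_nonneg_right hd hη0.le).trans hsum
      refine le_of_mul_le_mul_right (a := (n : ℝ)) ?_ hn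
      linarith
    have hpow : (d₀ * η) ^ (σ - 2) ≤ θ ^ (σ - 2) :=
      Real.rpow_le_rpow (by positivity) hθd (by linarith)
    calc κ ^ 2 * min 1 (η * (d₀ * η) ^ (σ - 2)) * w 0 ^ (3 - σ) * ∑ k, w k
        ≤ κ ^ 2 * (η * θ ^ (σ - 2)) * w 0 ^ (3 - σ) * (θ * n / η) := by
          gcongr
          exact (min_le_right _ _).trans (by gcongr)
      _ = κ ^ 2 * (w 0 ^ (3 - σ) * θ ^ (σ - 2)) * (θ * n) := by field_simp
      _ = κ ^ 2 * ((1 + i₀) * w 0 ^ 2) := by rw [← hkey]; field_simp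
      _ ≤ w ⬝ᵥ w := by push_cast at hT; linarith
  · have hT := hcount n le_rfl (by omega)
    have hSle : ∑ k, w k ≤ n * w 0 := by
      refine (Finset.sum_le_sum fun i _ => hwle i).trans ?_
      simp
    have hpw : w 0 ^ (3 - σ) ≤ w 0 := by
      conv_rhs => rw [← Real.rpow_one (w 0)]
      exact Real.rpow_le_rpow_of_exponent_le h1 (by linarith)
    calc κ ^ 2 * min 1 (η * (d₀ * η) ^ (σ - 2)) * w 0 ^ (3 - σ) * ∑ k, w k
        ≤ κ ^ 2 * 1 * w 0 * (n * w 0) := by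
          gcongr
          exact min_le_left _ _
      _ ≤ w ⬝ᵥ w := by linarith

theorem powerLaw_dotProduct_div_le [NeZero n] (hσ : 2 < σ) (hσ' : σ < 3) (hc : 0 < c) {d₁ : ℝ}
    (hd₁ : 0 < d₁) (hd : (∑ k, powerLaw σ c i₀ n k) / n ≤ d₁) :
    (powerLaw σ c i₀ n ⬝ᵥ powerLaw σ c i₀ n) / ∑ k, powerLaw σ c i₀ n k ≤
      (1 + 1 / (2 / (σ - 1) - 1)) * (2 ^ (-(1 / (σ - 1))))⁻¹ *
        (d₁ * (2 ^ (-(1 / (σ - 1))))⁻¹) ^ (σ - 2) * powerLaw σ c i₀ n 0 ^ (3 - σ) := by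
  have hn : (0 : ℝ) < n := by exact_mod_cast NeZero.pos n
  have hσ1 : 1 < σ := by linarith
  have hα0 : 0 ≤ 1 / (σ - 1) := div_nonneg zero_le_one (by linarith)
  have hS : 0 < ∑ k, powerLaw σ c i₀ n k :=
    Finset.sum_pos (fun i _ => powerLaw_pos hc i) Finset.univ_nonempty
  have hr : 1 < 2 / (σ - 1) := (one_lt_div (by linarith)).2 (by linarith)
  have hkey := mul_powerLaw_zero_sq_div (i₀ := i₀) (n := n) hσ1 hc
  have hhalf := two_rpow_mul_powerLaw_zero_le (n := n) (i₀ := i₀) hσ1 hc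
  have hlow := two_rpow_mul_le_powerLaw (n := n) (i₀ := i₀) hσ1 hc
  have hT := powerLaw_dotProduct_le (n := n) (i₀ := i₀) (c := c) hσ1 hσ'
  have hw0 : 0 < powerLaw σ c i₀ n 0 := powerLaw_pos hc 0
  have hwle : ∀ i, powerLaw σ c i₀ n i ≤ powerLaw σ c i₀ n 0 := powerLaw_le_powerLaw_zero hσ1 hc
  have hwpos : ∀ i, 0 < powerLaw σ c i₀ n i := powerLaw_pos hc
  set w := powerLaw σ c i₀ n with hw
  set α := 1 / (σ - 1) with hαdef
  set κ : ℝ := 2 ^ (-α) with hκ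
  set θ := c * (n : ℝ) ^ (-α) with hθ
  set R := 1 + 1 / (2 / (σ - 1) - 1) with hR
  have hκ0 : 0 < κ := by positivity
  have hκ1 : κ ≤ 1 := Real.rpow_le_one_of_one_le_of_nonpos (by norm_num) (by linarith)
  have hθ0 : 0 < θ := by positivity
  have hR1 : 1 ≤ R := by
    have : 0 ≤ 1 / (2 / (σ - 1) - 1) := div_nonneg zero_le_one (by linarith)
    linarith
  have hsum : ∀ x : ℝ, (∀ i, κ * x ≤ w i) → κ * x * n ≤ ∑ k, w k := fun x hx => by
    have := Finset.sum_le_sum fun (i : Fin n) (_ : i ∈ Finset.univ) => hx i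
    simpa [mul_comm] using this
  -- Used with x = θ when i₀ < n and with x = w₁ otherwise: a lower bound κx on all weights forces x
  -- to be at most d₁/κ.
  have hd' : ∀ x : ℝ, (∀ i, κ * x ≤ w i) → x ≤ d₁ * κ⁻¹ := fun x hx => by
    rw [le_mul_inv_iff₀ hκ0]
    refine le_of_mul_le_mul_right (a := (n : ℝ)) ?_ hn
    rw [div_le_iff₀ hn] at hd
    linarith [hsum x hx]
  rcases lt_or_ge i₀ n with hlt | hge
  · have hx : ∀ i, κ * θ ≤ w i := fun i => hlow i hlt
    calc (w ⬝ᵥ w) / ∑ k, w k ≤ R * ((1 + i₀) * w 0 ^ 2) / (κ * θ * n) := by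
          gcongr
          exact hsum θ hx
      _ = R * κ⁻¹ * ((1 + i₀) * w 0 ^ 2 / (θ * n)) := by field_simp
      _ = R * κ⁻¹ * θ ^ (σ - 2) * w 0 ^ (3 - σ) := by rw [hkey]; ring
      _ ≤ _ := by
          gcongr
          exact hd' θ hx
  · have hx : ∀ i, κ * w 0 ≤ w i := fun i => hhalf i (by have := i.2; omega)
    have h1 : (w ⬝ᵥ w) / ∑ k, w k ≤ w 0 := by
      rw [div_le_iff₀ hS, Finset.mul_sum]
      exact Finset.sum_le_sum fun i _ => mul_le_mul_of_nonneg_right (hwle i) (hwpos i).le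
    have h2 : w 0 = w 0 ^ (σ - 2) * w 0 ^ (3 - σ) := by
      rw [← Real.rpow_add hw0, show σ - 2 + (3 - σ) = 1 by ring, Real.rpow_one]
    have h3 : 1 ≤ R * κ⁻¹ := one_le_mul_of_one_le_of_one_le hR1 ((one_le_inv₀ hκ0).2 hκ1)
    calc (w ⬝ᵥ w) / ∑ k, w k ≤ w 0 ^ (σ - 2) * w 0 ^ (3 - σ) := h1.trans h2.le
      _ ≤ (d₁ * κ⁻¹) ^ (σ - 2) * w 0 ^ (3 - σ) := by
          gcongr
          exact hd' _ hx
      _ ≤ R * κ⁻¹ * ((d₁ * κ⁻¹) ^ (σ - 2) * w 0 ^ (3 - σ)) :=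
          le_mul_of_one_le_left (by positivity) h3
      _ = _ := by ring

end PowerLaw

/-! ### Random graphs with given expected degrees -/

section GivenDegrees

variable {n : ℕ} {w : Fin n → ℝ} {P : Matrix (Fin n) (Fin n) ℝ}

theorem abs_dotProduct_dropLoops_sub_le (h : ∀ i, |gwMatrix w i i| ≤ 1)
    (hP : P = gwMatrix w ∨ P = dropLoops (gwMatrix w)) (v : Fin n → ℝ) :
    |v ⬝ᵥ (P - gwMatrix w) *ᵥ v| ≤ v ⬝ᵥ v := by
  have hvv : 0 ≤ v ⬝ᵥ v := by rw [← l2Norm_sq]; positivity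
  rcases hP with rfl | rfl
  · simpa using hvv
  · have hd : dropLoops (gwMatrix w) - gwMatrix w =
        Matrix.diagonal fun i => -gwMatrix w i i := by
      ext i j
      by_cases hij : i = j
      · subst hij; simp [dropLoops]
      · simp [dropLoops, hij]
    rw [hd]
    simp only [dotProduct, Matrix.mulVec_diagonal]
    refine (Finset.abs_sum_le_sum_abs _ _).trans (Finset.sum_le_sum fun i _ => ?_)
    rw [show v i * (-gwMatrix w i i * v i) = -(gwMatrix w i i) * (v i * v i) by ring, abs_mul,
      abs_neg, abs_of_nonneg (mul_self_nonneg (v i))]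
    exact mul_le_of_le_one_left (mul_self_nonneg _) (h i)

/-- In the `G(w)` model the direction of `w` is nearly optimal with high probability as soon as the
largest eigenvalue of the mean dominates the fluctuations. -/
theorem one_sub_le_edgeLaw_isNearOptimal [NeZero n] (hw : ∀ i, 0 < w i) {d : ℝ}
    (hwd : ∀ i, w i ≤ d) (hd : d ≤ √(∑ k, w k))
    (hP : P = gwMatrix w ∨ P = dropLoops (gwMatrix w)) {ε δ β : ℝ} (hε : 0 < ε) (hε1 : ε < 1)
    (hδ : 0 < δ) (hδ1 : δ < 1) (hβ : 0 < β) (b : Fin n → ℝ) (hL : Real.log (2 * n / δ) ≤ d)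
    (hgap : 2 * √(d * Real.log (2 * n / δ)) + 1 ≤ ε / 16 * topEigenvalue (gwMatrix w)) :
    1 - δ ≤ (edgeLaw P).real {ω | β * topEigenvalue (adjacency ω) < 1 → ∀ C : ℝ,
      256 * l2Norm b ^ 2 / (ε * β * topEigenvalue (gwMatrix w)) ^ 2 ≤ C →
        IsNearOptimal ε β (adjacency ω) b C ((√C / l2Norm w) • w)} := by
  have hn : (1 : ℝ) ≤ n := by exact_mod_cast NeZero.pos n
  have hS : 0 < ∑ k, w k := Finset.sum_pos (fun i _ => hw i) Finset.univ_nonempty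
  have hd0 : 0 < d := (hw 0).trans_le (hwd 0)
  have hdd : d * d ≤ ∑ k, w k := by
    have := pow_le_pow_left₀ hd0.le hd 2
    rw [Real.sq_sqrt hS.le] at this
    linarith
  have hg0 : ∀ i j, 0 ≤ gwMatrix w i j := fun i j =>
    div_nonneg (mul_nonneg (hw i).le (hw j).le) hS.le
  have hg1 : ∀ i j, gwMatrix w i j ≤ 1 := fun i j => by
    rw [gwMatrix, div_le_one hS]
    exact (mul_le_mul (hwd i) (hwd j) (hw j).le hd0.le).trans hdd
  have hgrow : ∀ i, ∑ j, gwMatrix w i j ≤ d := fun i => by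
    simp only [gwMatrix]
    rw [← Finset.sum_div, ← Finset.mul_sum, mul_div_assoc, div_self hS.ne', mul_one]
    exact hwd i
  have hPg : ∀ i j, 0 ≤ P i j ∧ P i j ≤ gwMatrix w i j := fun i j => by
    rcases hP with rfl | rfl
    · exact ⟨hg0 i j, le_rfl⟩
    · rw [dropLoops]
      split_ifs
      · exact ⟨le_rfl, hg0 i j⟩
      · exact ⟨hg0 i j, le_rfl⟩
  have hPt : Pᵀ = P := by
    rcases hP with rfl | rfl
    · exact gwMatrix_transpose w
    · ext i j
      simp [dropLoops, gwMatrix, eq_comm, mul_comm]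
  have hδn : 1 < 2 * n / δ := by rw [lt_div_iff₀ hδ]; linarith
  have hconc := one_sub_le_edgeLaw_real hPt (fun i j => (hPg i j).1)
    (fun i j => (hPg i j).2.trans (hg1 i j))
    (fun i => (Finset.sum_le_sum fun j _ => (hPg i j).2).trans (hgrow i)) (Real.log_pos hδn) hL
  -- L = log(2n/δ) is chosen so that the failure probability is exactly δ.
  have hexp : 2 * (n * Real.exp (-Real.log (2 * n / δ))) = δ := by
    rw [Real.exp_neg, Real.exp_log (by linarith)]
    field_simp
  rw [hexp] at hconc
  refine hconc.trans (MeasureTheory.measureReal_mono fun ω hω hβω C hC => ?_)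
  have hT : 0 < w ⬝ᵥ w := Finset.sum_pos (fun i _ => mul_pos (hw i) (hw i)) Finset.univ_nonempty
  have hN : 0 < l2Norm w := by
    have := l2Norm_sq w
    exact lt_of_le_of_ne (l2Norm_nonneg w) fun h => by rw [← h] at this; simp at this; linarith
  have hμ : 0 < topEigenvalue (gwMatrix w) := by
    rw [topEigenvalue_gwMatrix hw]; positivity
  have hunit : l2Norm ((l2Norm w)⁻¹ • w) = 1 := by
    rw [l2Norm_smul, abs_of_pos (inv_pos.2 hN), inv_mul_cancel₀ hN.ne']
  have hdir : (√C / l2Norm w) • w = √C • ((l2Norm w)⁻¹ • w) := by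
    rw [smul_smul, div_eq_mul_inv]
  rw [hdir]
  refine isNearOptimal_of_near_rank_one (adjacency_transpose ω) hβ hβω hunit hμ hε hε1
    (fun v => ?_) hC
  have hvv : 0 ≤ v ⬝ᵥ v := by rw [← l2Norm_sq]; positivity
  have hrank : topEigenvalue (gwMatrix w) * (v ⬝ᵥ (l2Norm w)⁻¹ • w) ^ 2 =
      v ⬝ᵥ gwMatrix w *ᵥ v := by
    rw [topEigenvalue_gwMatrix hw, dotProduct_gwMatrix_mulVec, dotProduct_smul, smul_eq_mul,
      mul_pow, inv_pow, l2Norm_sq]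
    field_simp
  have hsplit : v ⬝ᵥ adjacency ω *ᵥ v - v ⬝ᵥ gwMatrix w *ᵥ v =
      v ⬝ᵥ (adjacency ω - P) *ᵥ v + v ⬝ᵥ (P - gwMatrix w) *ᵥ v := by
    simp only [Matrix.sub_mulVec, dotProduct_sub]
    ring
  -- Removing loops changes the mean by a diagonal with entries of modulus at most 1, which is the
  -- summand 1 in `hgap`.
  have h1 := abs_dotProduct_dropLoops_sub_le
    (fun i => by rw [abs_of_nonneg (hg0 i i)]; exact hg1 i i) hP v
  have h2 := hω v
  rw [hrank, hsplit]
  have h3 := mul_le_mul_of_nonneg_right hgap hvv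
  linarith [abs_add_le (v ⬝ᵥ (adjacency ω - P) *ᵥ v) (v ⬝ᵥ (P - gwMatrix w) *ᵥ v)]

end GivenDegrees

/-- After squaring, the gap asks that x^(5-2σ) dominate a multiple of L/ε²; the assumption supplies
L/ε⁴. The summand 2 in the base of the constant, with L ≥ 1/2, forces x ≥ 1 and L ≤ x. The summand
(64/c₁)² drives the gap, with 64 = 16 · 4 because 2√(xL) + 1 ≤ 4√(xL). -/
theorem spectral_gap_of_le {σ c₁ x L ε μ : ℝ} (hσ : 2 < σ) (hσ' : σ < 5 / 2) (hc₁ : 0 < c₁)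
    (hL : 1 / 2 ≤ L) (hε : 0 < ε) (hε1 : ε < 1) (hμ : c₁ * x ^ (3 - σ) ≤ μ)
    (hx : (2 + (64 / c₁) ^ 2) ^ (1 / (5 - 2 * σ)) * (L / ε ^ 4) ^ (1 / (5 - 2 * σ)) ≤ x) :
    1 ≤ x ∧ L ≤ x ∧ 2 * √(x * L) + 1 ≤ ε / 16 * μ := by
  have hs : 0 < 5 - 2 * σ := by linarith
  have hL0 : 0 < L := by linarith
  set B := 2 + (64 / c₁) ^ 2 with hB
  have hB0 : 0 < B := by positivity
  rw [← Real.mul_rpow hB0.le (by positivity)] at hx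
  have hxpos : 0 < x := lt_of_lt_of_le (by positivity) hx
  have hxs : B * (L / ε ^ 4) ≤ x ^ (5 - 2 * σ) := by
    have h := Real.rpow_le_rpow (by positivity) hx hs.le
    rwa [← Real.rpow_mul (by positivity), one_div_mul_cancel hs.ne', Real.rpow_one] at h
  have hε2 : ε ^ 2 ≤ 1 := pow_le_one₀ hε.le hε1.le
  have hLε : L ≤ L / ε ^ 4 := by
    rw [le_div_iff₀ (by positivity)]
    exact mul_le_of_le_one_right hL0.le (pow_le_one₀ hε.le hε1.le)
  have hB2 : 2 ≤ B := by rw [hB]; linarith [sq_nonneg (64 / c₁)]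
  have hxs2 : 2 * L ≤ x ^ (5 - 2 * σ) :=
    (mul_le_mul hB2 hLε hL0.le hB0.le).trans hxs
  have hx1 : 1 ≤ x := by
    by_contra! hlt
    have := Real.rpow_lt_one hxpos.le hlt hs
    linarith
  have hLx : L ≤ x := by
    have : x ^ (5 - 2 * σ) ≤ x := by
      conv_rhs => rw [← Real.rpow_one x]
      exact Real.rpow_le_rpow_of_exponent_le hx1 (by linarith)
    linarith
  refine ⟨hx1, hLx, ?_⟩
  have hxL : 1 / 4 ≤ x * L := by nlinarith
  have hsq1 : 1 ≤ 2 * √(x * L) := by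
    have : (1 / 2 : ℝ) ≤ √(x * L) := Real.le_sqrt_of_sq_le (by linarith)
    linarith
  have hμ2 : 64 * √(x * L) ≤ ε * (c₁ * x ^ (3 - σ)) := by
    refine abs_le_of_sq_le_sq' ?_ (by positivity) |>.2
    have hxx : (x ^ (3 - σ)) ^ 2 = x * x ^ (5 - 2 * σ) := by
      rw [← Real.rpow_natCast, ← Real.rpow_mul hxpos.le]
      conv_rhs => rw [← Real.rpow_one_add' hxpos.le (by linarith)]
      congr 1
      push_cast
      ring
    have h1 : (64 / c₁) ^ 2 * (L / ε ^ 4) ≤ x ^ (5 - 2 * σ) :=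
      le_trans (by gcongr; linarith) hxs
    rw [mul_pow, mul_pow, mul_pow, hxx, Real.sq_sqrt (by positivity)]
    calc (64 : ℝ) ^ 2 * (x * L) ≤ 64 ^ 2 * (x * L) / ε ^ 2 := by
          rw [le_div_iff₀ (by positivity)]
          exact mul_le_of_le_one_right (by positivity) hε2
      _ = ε ^ 2 * (c₁ ^ 2 * (x * ((64 / c₁) ^ 2 * (L / ε ^ 4)))) := by field_simp
      _ ≤ ε ^ 2 * (c₁ ^ 2 * (x * x ^ (5 - 2 * σ))) := by gcongr
  have h3 := mul_le_mul_of_nonneg_left hμ hε.le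
  linarith

end NetGame

end

theorem mainTheorem4 (σ : ℝ) (hσ : 2 < σ) (hσ' : σ < 5 / 2) (d₀ : ℝ) (hd₀ : 0 < d₀) :
    ∃ K : ℝ, 0 < K ∧ ∃ c₁ : ℝ, 0 < c₁ ∧ ∀ d₁ : ℝ, ∃ c₂ : ℝ, 0 < c₂ ∧
      ∀ (n : ℕ) [NeZero n] (c : ℝ) (i₀ : ℕ) (w : Fin n → ℝ) (ε δ : ℝ),
        0 < c → w = NetGame.powerLaw σ c i₀ n →
        0 < ε → ε < 1 → 0 < δ → δ < 1 →
        -- every edge probability is at most one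
        w 0 ≤ √(∑ k, w k) →
        -- the average expected degree
        d₀ ≤ (∑ k, w k) / n → (∑ k, w k) / n ≤ d₁ →
        K * (Real.log (2 * n / δ) / ε ^ 4) ^ (1 / (5 - 2 * σ)) ≤ w 0 →
        (c₁ * w 0 ^ (3 - σ) ≤ NetGame.topEigenvalue (NetGame.gwMatrix w) ∧
          NetGame.topEigenvalue (NetGame.gwMatrix w) ≤ c₂ * w 0 ^ (3 - σ)) ∧
        -- with or without self-loops
        ∀ P : Matrix (Fin n) (Fin n) ℝ,
          (P = NetGame.gwMatrix w ∨ P = NetGame.dropLoops (NetGame.gwMatrix w)) →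
          ∀ (β : ℝ) (b : Fin n → ℝ), 0 < β → (∀ i, 0 ≤ b i) →
            1 - δ ≤ (NetGame.edgeLaw P).real
              {ω | β * NetGame.topEigenvalue (NetGame.adjacency ω) < 1 →
                ∀ C : ℝ,
                  256 * NetGame.l2Norm b ^ 2 /
                      (ε * β * NetGame.topEigenvalue (NetGame.gwMatrix w)) ^ 2 ≤ C →
                  NetGame.IsNearOptimal ε β (NetGame.adjacency ω) b C
                    ((√C / NetGame.l2Norm w) • w)} := by
  have hα : 0 < 1 - 1 / (σ - 1) := sub_pos.2 ((div_lt_one (by linarith)).2 (by linarith))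
  have hr : 0 < 2 / (σ - 1) - 1 := sub_pos.2 ((one_lt_div (by linarith)).2 (by linarith))
  set c₁ : ℝ := (2 ^ (-(1 / (σ - 1)))) ^ 2 *
    min 1 ((1 - 1 / (σ - 1)) * (d₀ * (1 - 1 / (σ - 1))) ^ (σ - 2)) with hc₁
  have hc₁0 : 0 < c₁ := by positivity
  -- Here d₁ is an arbitrary real, so `max d₀ d₁` keeps c₂ positive without weakening the upper
  -- bound on the average degree.
  refine ⟨(2 + (64 / c₁) ^ 2) ^ (1 / (5 - 2 * σ)), by positivity, c₁, hc₁0, fun d₁ =>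
    ⟨(1 + 1 / (2 / (σ - 1) - 1)) * (2 ^ (-(1 / (σ - 1))))⁻¹ *
      (max d₀ d₁ * (2 ^ (-(1 / (σ - 1))))⁻¹) ^ (σ - 2), by positivity, ?_⟩⟩
  intro n _ c i₀ w ε δ hc hw hε hε1 hδ hδ1 hwS hd hd' hK
  subst hw
  have hpos := NetGame.powerLaw_pos (σ := σ) (i₀ := i₀) (n := n) hc
  have hle := NetGame.powerLaw_le_powerLaw_zero (n := n) (i₀ := i₀) (by linarith : 1 < σ) hc
  have hn : (1 : ℝ) ≤ n := by exact_mod_cast NeZero.pos n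
  have hL : 1 / 2 ≤ Real.log (2 * n / δ) := by
    have h2 : (2 : ℝ) ≤ 2 * n / δ := by rw [le_div_iff₀ hδ]; nlinarith
    linarith [Real.log_le_log two_pos h2, Real.log_two_gt_d9]
  have htop := NetGame.topEigenvalue_gwMatrix hpos
  -- A first application, with μ equal to its own lower bound, yields only w₁ ≥ 1. The lower bound
  -- on the eigenvalue needs this, and with that bound the lemma is applied again for the actual
  -- gap.
  obtain ⟨h1, -, -⟩ := NetGame.spectral_gap_of_le hσ hσ' hc₁0 hL hε hε1 le_rfl hK
  have hlow : c₁ * NetGame.powerLaw σ c i₀ n 0 ^ (3 - σ) ≤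
      NetGame.topEigenvalue (NetGame.gwMatrix (NetGame.powerLaw σ c i₀ n)) := by
    rw [htop]
    exact NetGame.le_powerLaw_dotProduct_div hσ hc hd₀ h1 hd
  obtain ⟨-, hLw, hgap⟩ := NetGame.spectral_gap_of_le hσ hσ' hc₁0 hL hε hε1 hlow hK
  refine ⟨⟨hlow, ?_⟩, fun P hP β b hβ _ => ?_⟩
  · rw [htop]
    exact NetGame.powerLaw_dotProduct_div_le hσ (by linarith) hc (lt_max_of_lt_left hd₀)
      (hd'.trans (le_max_right _ _))
  · exact NetGame.one_sub_le_edgeLaw_isNearOptimal hpos hle hwS hP hε hε1 hδ hδ1 hβ b hLw hgap
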